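/- Consider finite rooted planar (ordered) trees $T$ whose root has degree $1$. The size $|T|$ is the number of edges, and the height $h(T)$ is the maximal graph distance of a vertex from the root. The left-most path of $T$ starts at the root and passes from each vertex to its left-most child until it reaches a leaf; $T$ is called one-sided if the length of this path equals $h(T)$. For $m,N\ge 1$ let $B_{m,N}$ be the number of one-sided trees of height $m$ and size $N$, and for $\mu\in\mathbb R$ let $$W_N^{(\mu)}=\sum_{m=1}^{\infty}e^{-\mu m}B_{m,N}$$ (a finite sum, since $B_{m,N}=0$ for $m>N$). Let $\mu_0=-\ln 2$. Theorem. For each $\mu>\mu_0$ and each $\delta\in(0,\tfrac16)$, $$W_N^{(\mu)}=4\,e^{\mu}\,\sqrt{\frac{\pi}{B}}\;\frac{\mu+\ln 2}{2}\;e^{-A N^{1/3}}\,N^{-5/6}\,4^{N}\,\bigl(1+O(N^{-\delta})\bigr)\qquad\text{as } N\to\infty,$$ where $$A=3\Bigl(\frac{\pi(\mu+\ln 2)}{2}\Bigr)^{2/3},\qquad B=3\Bigl(\frac{(\mu+\ln 2)^2}{4\pi}\Bigr)^{2/3},$$ and the constant implied by $O(\cdot)$ may depend on $\mu$ and $\delta$.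 -/

import Mathlib

open Asymptotics Filter

/-- Finite planar rooted trees: a root vertex together with the list, ordered from left to right,
of the subtrees hanging at its children. -/
inductive PlaneTree : Type
  | node (children : List PlaneTree) : PlaneTree

namespace PlaneTree

/-- The subtrees hanging at the children of the root, from left to right. -/
def children : PlaneTree → List PlaneTree
  | node cs => cs

/-- The size `|T|`: the number of edges. -/
def size : PlaneTree → ℕ
  | node cs => (cs.map fun c => size c + 1).sum

/-- The height `h(T)`: the maximal graph distance of a vertex from the root. -/
def height : PlaneTree → ℕ
  | node cs => (cs.map fun c => height c + 1).foldr max 0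

/-- The number of edges of the left-most path, which starts at the root and goes from each vertex
to its left-most child until it arrives at a leaf. Its `k`-th vertex is the left-most vertex
at distance `k` from the root, and it is the longest path from the root with this property. -/
def leftmostLength : PlaneTree → ℕ
  | node [] => 0
  | node (c :: _) => leftmostLength c + 1

/-- The trees under consideration: the root has degree one. -/
def IsPlanted (T : PlaneTree) : Prop := T.children.length = 1

/-- One-sided trees: planted trees whose left-most path has length equal to the height. -/
def IsOneSided (T : PlaneTree) : Prop := T.IsPlanted ∧ T.leftmostLength = T.height

end PlaneTree

/-- `B_{m,N}`: the number of one-sided trees of height `m` and size `N`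
(there are finitely many trees of a given size). -/
noncomputable def numOneSided (m N : ℕ) : ℕ :=
  {T : PlaneTree | T.IsOneSided ∧ T.height = m ∧ T.size = N}.ncard

/-- The partition function `W_N^{(μ)} = ∑_{m ≥ 1} e^{-μ m} B_{m,N}`
(only terms with `m ≤ N` are nonzero). -/
noncomputable def partitionFunction (μ : ℝ) (N : ℕ) : ℝ :=
  ∑' k : ℕ, Real.exp (-μ * ((k + 1 : ℕ) : ℝ)) * (numOneSided (k + 1) N : ℝ)

/-- The critical coupling `μ₀ = -ln 2`. -/
noncomputable def criticalCoupling : ℝ := -Real.log 2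

/-- `A = 3 (π (μ + ln 2) / 2)^{2/3}`. -/
noncomputable def constA (μ : ℝ) : ℝ :=
  3 * (Real.pi * (μ + Real.log 2) / 2) ^ ((2 : ℝ) / 3)

/-- `B = 3 ((μ + ln 2)² / (4π))^{2/3}`. -/
noncomputable def constB (μ : ℝ) : ℝ :=
  3 * ((μ + Real.log 2) ^ 2 / (4 * Real.pi)) ^ ((2 : ℝ) / 3)

/-! Cutting off the left-most branch makes a plane tree a pair of smaller trees. With `X ^ 2`
marking an edge, trees of bounded height have generating function `fib h / fib (h + 1)`, and the
product over the left-most path telescopes to a series `X ^ (2 * m) / fib (m + 1)`. Walks between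
the two ends of a path graph lead to the same denominator, and diagonalising the path graph gives
`B_{m,N}` as an alternating trigonometric sum over the angles kπ/n, n = m + 1.

Put c = μ + ln 2. After factoring out 4^N e^μ, the terms k = 1 and k = n - 1 coincide and dominate;
together they contribute about (4π²/n³) exp(-cn - π²N/n²). The saddle is n = L with L³ = 2π²N/c. The
exponent there is -3cL/2 = -A N^{1/3}, and its quadratic part is -(3c/2)(n - L)²/L. Summing over n
gives the Gaussian integral √(2πL/(3c)) = √(π/B) N^{1/6}.

After normalisation every error sums to O(1), while the main term has order √L, that is N^{1/6}. The
relative error is therefore O(N^{-1/6}). The main ingredients are `numOneSided_eq_sum` (exact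
formula), `exists_term_bound` (termwise Gaussian approximation), `exists_gaussian_nat_sum_bound`
(Gaussian sums, by Poisson summation) and `exists_saddle_sum_bound`. -/

namespace PlaneTree

/-! ### Plane trees as pairs: left-most branch and remainder -/

/-- The tree obtained from `r` by attaching `c` to the root of `r` as its new left-most branch. -/
def graft (c r : PlaneTree) : PlaneTree := node (c :: r.children)

/-- The tree with a single vertex. -/
def leaf : PlaneTree := node []

@[simp] lemma size_leaf : leaf.size = 0 := by simp [leaf, size]

@[simp] lemma height_leaf : leaf.height = 0 := by simp [leaf, height]

@[simp] lemma leftmostLength_leaf : leaf.leftmostLength = 0 := by simp [leaf, leftmostLength]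

lemma size_graft (c r : PlaneTree) : (graft c r).size = c.size + r.size + 1 := by
  cases r; simp [graft, size, children]; ring

lemma height_graft (c r : PlaneTree) : (graft c r).height = max (c.height + 1) r.height := by
  cases r; simp [graft, height, children]

lemma leftmostLength_graft (c r : PlaneTree) :
    (graft c r).leftmostLength = c.leftmostLength + 1 := by
  simp [graft, leftmostLength]

lemma graft_injective {c r c' r' : PlaneTree} (h : graft c r = graft c' r') : c = c' ∧ r = r' := by
  cases r; cases r'; simpa [graft, children] using h

lemma graft_ne_leaf (c r : PlaneTree) : graft c r ≠ leaf := by simp [graft, leaf]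

lemma eq_leaf_or_graft (T : PlaneTree) : T = leaf ∨ ∃ c r, T = graft c r := by
  rcases T with ⟨_ | ⟨c, r⟩⟩
  · exact Or.inl rfl
  · exact Or.inr ⟨c, node r, rfl⟩

lemma graft_induction {p : PlaneTree → Prop} (h0 : p leaf)
    (h1 : ∀ c r, p c → p r → p (graft c r)) (T : PlaneTree) : p T := by
  induction hn : T.size using Nat.strong_induction_on generalizing T with
  | _ n ih =>
    subst hn
    rcases eq_leaf_or_graft T with rfl | ⟨c, r, rfl⟩
    · exact h0
    · have := size_graft c r
      exact h1 c r (ih _ (by omega) c rfl) (ih _ (by omega) r rfl)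

lemma leftmostLength_le_height (T : PlaneTree) : T.leftmostLength ≤ T.height := by
  induction T using graft_induction with
  | h0 => simp
  | h1 c r hc hr => rw [leftmostLength_graft, height_graft]; omega

lemma height_le_size (T : PlaneTree) : T.height ≤ T.size := by
  induction T using graft_induction with
  | h0 => simp
  | h1 c r hc hr => rw [size_graft, height_graft]; omega

lemma finite_size_eq (n : ℕ) : {T : PlaneTree | T.size = n}.Finite := by
  induction n using Nat.strong_induction_on with
  | _ n ih =>
    have hfin : {T : PlaneTree | T.size < n}.Finite := by
      have : {T : PlaneTree | T.size < n} = ⋃ i ∈ Finset.range n, {T | T.size = i} := by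
        ext T; simp
      rw [this]
      exact Set.Finite.biUnion (Finset.finite_toSet _) fun i hi => ih i (by simpa using hi)
    refine ((hfin.image2 graft hfin).union (Set.finite_singleton leaf)).subset ?_
    intro T hT
    rcases eq_leaf_or_graft T with rfl | ⟨c, r, rfl⟩
    · simp
    · left
      have h := size_graft c r
      simp only [Set.mem_ofPred_eq] at hT
      exact ⟨c, by simp; omega, r, by simp; omega, rfl⟩

/-! ### Generating functions and the height recursions -/

lemma finite_sep_size (X : Set PlaneTree) (k : ℕ) : {T ∈ X | 2 * T.size = k}.Finite :=
  (finite_size_eq (k / 2)).subset fun T hT => by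
    have := hT.2
    simp only [Set.mem_ofPred_eq]
    omega

/-- The generating function `∑_{T ∈ X} t ^ (2 |T|)`. -/
noncomputable def gf (X : Set PlaneTree) : PowerSeries ℝ :=
  PowerSeries.mk fun k => ({T ∈ X | 2 * T.size = k}.ncard : ℝ)

lemma coeff_gf (X : Set PlaneTree) (k : ℕ) :
    PowerSeries.coeff k (gf X) = ({T ∈ X | 2 * T.size = k}.ncard : ℝ) := by
  simp [gf]

lemma gf_leaf : gf {leaf} = 1 := by
  ext k
  rw [coeff_gf, PowerSeries.coeff_one]
  split_ifs with h
  · subst h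
    have : {T ∈ ({leaf} : Set PlaneTree) | 2 * T.size = 0} = {leaf} := by
      ext T; simp +contextual
    rw [this]; simp
  · have : {T ∈ ({leaf} : Set PlaneTree) | 2 * T.size = k} = ∅ := by
      ext T; simp only [Set.mem_singleton_iff, Set.mem_ofPred_eq, Set.mem_empty_iff_false, iff_false]
      rintro ⟨rfl, h2⟩
      simp at h2; omega
    rw [this]; simp

lemma gf_union {X Y : Set PlaneTree} (h : Disjoint X Y) : gf (X ∪ Y) = gf X + gf Y := by
  ext k
  rw [map_add, coeff_gf, coeff_gf, coeff_gf]
  have : {T ∈ X ∪ Y | 2 * T.size = k} = {T ∈ X | 2 * T.size = k} ∪ {T ∈ Y | 2 * T.size = k} := by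
    ext T; simp [or_and_right]
  rw [this, Set.ncard_union_eq _ (finite_sep_size _ _) (finite_sep_size _ _)]
  · push_cast; rfl
  · exact h.mono (Set.sep_subset _ _) (Set.sep_subset _ _)

lemma gf_image2_graft (X Y : Set PlaneTree) :
    gf (Set.image2 graft X Y) = PowerSeries.X ^ 2 * gf X * gf Y := by
  ext k
  rw [mul_assoc, PowerSeries.coeff_X_pow_mul', coeff_gf]
  split_ifs with hk
  · obtain ⟨k, rfl⟩ := Nat.exists_eq_add_of_le' hk
    rw [Nat.add_sub_cancel, PowerSeries.coeff_mul]
    have key : {T ∈ Set.image2 graft X Y | 2 * T.size = k + 2} =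
        ⋃ p ∈ (Finset.HasAntidiagonal.antidiagonal k : Finset (ℕ × ℕ)), (fun q : PlaneTree × PlaneTree => graft q.1 q.2) ''
          ({T ∈ X | 2 * T.size = p.1} ×ˢ {T ∈ Y | 2 * T.size = p.2}) := by
      ext T
      simp only [Set.mem_image2, Set.mem_ofPred_eq, Set.mem_iUnion, Set.mem_image, Set.mem_prod,
        Finset.HasAntidiagonal.mem_antidiagonal, Prod.exists]
      constructor
      · rintro ⟨⟨c, hc, r, hr, rfl⟩, hs⟩
        rw [size_graft] at hs
        exact ⟨2 * c.size, 2 * r.size, by omega, c, r, ⟨⟨hc, rfl⟩, hr, rfl⟩, rfl⟩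
      · rintro ⟨i, j, hij, c, r, ⟨⟨hc, h1⟩, hr, h2⟩, rfl⟩
        refine ⟨⟨c, hc, r, hr, rfl⟩, ?_⟩
        rw [size_graft]; omega
    have hinj : Function.Injective (fun q : PlaneTree × PlaneTree => graft q.1 q.2) := by
      intro q q' h
      obtain ⟨h1, h2⟩ := graft_injective h
      exact Prod.ext h1 h2
    have hU := Set.Finite.ncard_biUnion
      (Finset.finite_toSet (Finset.HasAntidiagonal.antidiagonal k : Finset (ℕ × ℕ)))
      (s := fun p => (fun q : PlaneTree × PlaneTree => graft q.1 q.2) ''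
          ({T ∈ X | 2 * T.size = p.1} ×ˢ {T ∈ Y | 2 * T.size = p.2}))
      (fun p _ => ((finite_sep_size X p.1).prod (finite_sep_size Y p.2)).image _) (by
        intro p _ p' _ hne
        rw [Function.onFun, Set.disjoint_left]
        rintro _ ⟨q, ⟨h1, h2⟩, rfl⟩ ⟨q', ⟨h1', h2'⟩, he⟩
        obtain rfl := hinj he
        exact hne (Prod.ext (h1.2.symm.trans h1'.2) (h2.2.symm.trans h2'.2)))
    simp only [Finset.mem_coe] at hU
    rw [key, hU, finsum_mem_finset_eq_sum, Nat.cast_sum]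
    refine Finset.sum_congr rfl fun p _ => ?_
    rw [Set.ncard_image_of_injective _ hinj, Set.ncard_prod, Nat.cast_mul, coeff_gf, coeff_gf]
  · have : {T ∈ Set.image2 graft X Y | 2 * T.size = k} = ∅ := by
      ext T
      simp only [Set.mem_image2, Set.mem_ofPred_eq, Set.mem_empty_iff_false, iff_false]
      rintro ⟨⟨c, hc, r, hr, rfl⟩, hs⟩
      rw [size_graft] at hs; omega
    rw [this]; simp

/-- Trees of height at most `h`. -/
def heightLE (h : ℕ) : Set PlaneTree := {T | T.height ≤ h}

/-- Trees of height `m` whose left-most path has length `m`. -/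
def leftHigh (m : ℕ) : Set PlaneTree := {T | T.leftmostLength = m ∧ T.height = m}

lemma height_eq_zero_iff (T : PlaneTree) : T.height = 0 ↔ T = leaf := by
  rcases eq_leaf_or_graft T with rfl | ⟨c, r, rfl⟩
  · simp
  · simp [height_graft, graft_ne_leaf]

lemma heightLE_zero : heightLE 0 = {leaf} := by
  ext T; simp [heightLE, height_eq_zero_iff]

lemma leftHigh_zero : leftHigh 0 = {leaf} := by
  ext T
  simp only [leftHigh, Set.mem_ofPred_eq, height_eq_zero_iff, Set.mem_singleton_iff]
  exact ⟨fun h => h.2, fun h => by simp [h]⟩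

/-- The left-most branch sits one level below the root and loses one unit of height; the remainder
keeps the root and hence the bound. -/
lemma heightLE_succ (h : ℕ) :
    heightLE (h + 1) = {leaf} ∪ Set.image2 graft (heightLE h) (heightLE (h + 1)) := by
  ext T
  rcases eq_leaf_or_graft T with rfl | ⟨c, r, rfl⟩
  · simp [heightLE]
  · simp only [heightLE, Set.mem_ofPred_eq, height_graft, Set.singleton_union, Set.mem_insert_iff,
      graft_ne_leaf, false_or, Set.mem_image2]
    constructor
    · intro hh
      exact ⟨c, by omega, r, by omega, rfl⟩
    · rintro ⟨c', hc, r', hr, he⟩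
      obtain ⟨rfl, rfl⟩ := graft_injective he
      omega

lemma leftHigh_succ (m : ℕ) :
    leftHigh (m + 1) = Set.image2 graft (leftHigh m) (heightLE (m + 1)) := by
  ext T
  rcases eq_leaf_or_graft T with rfl | ⟨c, r, rfl⟩
  · simp [leftHigh, graft_ne_leaf]
  · simp only [leftHigh, heightLE, Set.mem_ofPred_eq, height_graft, leftmostLength_graft,
      Set.mem_image2]
    constructor
    · intro hh
      -- Forces the branch to have height exactly `m`: its left-most path already has that length.
      have := leftmostLength_le_height c
      exact ⟨c, by omega, r, by omega, rfl⟩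
    · rintro ⟨c', hc, r', hr, he⟩
      obtain ⟨rfl, rfl⟩ := graft_injective he
      omega

lemma setOf_isOneSided (m : ℕ) :
    {T : PlaneTree | T.IsOneSided ∧ T.height = m + 1} = Set.image2 graft (leftHigh m) {leaf} := by
  ext T
  rcases eq_leaf_or_graft T with rfl | ⟨c, r, rfl⟩
  · simp [graft_ne_leaf]
  · simp only [IsOneSided, IsPlanted, leftHigh, Set.mem_ofPred_eq, height_graft,
      leftmostLength_graft, Set.mem_image2]
    constructor
    · rintro ⟨⟨h1, h2⟩, h3⟩
      have hr : r = leaf := by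
        rcases r with ⟨cs⟩
        simpa [graft, children, leaf] using h1
      subst hr
      rw [height_leaf] at h2 h3
      exact ⟨c, by omega, leaf, rfl, rfl⟩
    · rintro ⟨c', hc, r', hr, he⟩
      obtain ⟨rfl, rfl⟩ := graft_injective he
      rw [Set.mem_singleton_iff] at hr
      subst hr
      rw [height_leaf]
      refine ⟨⟨by simp [graft, children, leaf], by omega⟩, by omega⟩

lemma gf_heightLE_succ (h : ℕ) :
    gf (heightLE (h + 1)) = 1 + PowerSeries.X ^ 2 * gf (heightLE h) * gf (heightLE (h + 1)) := by
  conv_lhs => rw [heightLE_succ]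
  rw [gf_union, gf_leaf, gf_image2_graft]
  rw [Set.disjoint_singleton_left]
  rintro ⟨c, _, r, _, h⟩
  exact graft_ne_leaf c r h

/-- The polynomials whose quotients are the generating functions of trees of bounded height. -/
noncomputable def fib : ℕ → PowerSeries ℝ
  | 0 => 1
  | 1 => 1
  | n + 2 => fib (n + 1) - PowerSeries.X ^ 2 * fib n

lemma gf_heightLE_mul_fib (h : ℕ) : gf (heightLE h) * fib (h + 1) = fib h := by
  induction h with
  | zero => simp [heightLE_zero, gf_leaf, fib]
  | succ h ih =>
    have h1 := gf_heightLE_succ h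
    rw [fib]
    linear_combination (exp := 1) fib (h + 1) * h1 +
      PowerSeries.X ^ 2 * gf (heightLE (h + 1)) * ih

/-- Each vertex of the left-most path contributes a factor `X ^ 2 * fib (m + 1) / fib (m + 2)`, and
the product telescopes. -/
lemma gf_leftHigh_mul_fib (m : ℕ) :
    gf (leftHigh m) * fib (m + 1) = PowerSeries.X ^ (2 * m) := by
  induction m with
  | zero => simp [leftHigh_zero, gf_leaf, fib]
  | succ m ih =>
    rw [leftHigh_succ, gf_image2_graft, mul_assoc, gf_heightLE_mul_fib, mul_assoc, ih]
    ring

end PlaneTree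

/-- The single edge at the root accounts for the shift by one in both height and size. -/
lemma coeff_gf_leftHigh (m N : ℕ) :
    PowerSeries.coeff (2 * N) (PlaneTree.gf (PlaneTree.leftHigh m)) =
      (numOneSided (m + 1) (N + 1) : ℝ) := by
  have h : (numOneSided (m + 1) (N + 1) : ℝ) = PowerSeries.coeff (2 * (N + 1))
      (PlaneTree.gf {T : PlaneTree | T.IsOneSided ∧ T.height = m + 1}) := by
    rw [PlaneTree.coeff_gf, numOneSided]
    congr 2
    ext T
    simp [and_assoc]
  rw [h, PlaneTree.setOf_isOneSided, PlaneTree.gf_image2_graft, PlaneTree.gf_leaf, mul_one,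
    mul_add, mul_one, add_comm, PowerSeries.coeff_X_pow_mul', if_pos (by omega)]
  congr 2
  omega

lemma numOneSided_eq_zero {m N : ℕ} (h : N < m) : numOneSided m N = 0 := by
  have : {T : PlaneTree | T.IsOneSided ∧ T.height = m ∧ T.size = N} = ∅ := by
    ext T
    simp only [Set.mem_ofPred_eq, Set.mem_empty_iff_false, iff_false]
    rintro ⟨-, h1, h2⟩
    have := T.height_le_size
    omega
  rw [numOneSided, this, Set.ncard_empty]

/-! ### Path-graph walks and the spectral formula -/

/-- Cosine sums over equidistributed angles. -/
lemma sum_range_cos_mul_pi_div {M j : ℕ} (hj : 0 < j) (hjM : j < 2 * M) :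
    ∑ k ∈ Finset.range M, Real.cos (k * j * Real.pi / M) = (1 - (-1) ^ j) / 2 := by
  have hM : (0 : ℝ) < M := by exact_mod_cast (by omega : 0 < M)
  set α : ℝ := j * Real.pi / (2 * M) with hα
  have hs : Real.sin α ≠ 0 := by
    refine (Real.sin_pos_of_pos_of_lt_pi ?_ ?_).ne'
    · have := Real.pi_pos
      positivity
    · rw [hα, div_lt_iff₀ (by positivity), mul_comm Real.pi]
      have : (j : ℝ) < 2 * M := by exact_mod_cast hjM
      exact mul_lt_mul_of_pos_right this Real.pi_pos
  -- Multiplying by `2 * sin α` turns each cosine into a difference of sines of consecutive odd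
  -- multiples of `α`.
  have htel : ∀ m : ℕ, ∑ k ∈ Finset.range m, 2 * Real.sin α * Real.cos (k * j * Real.pi / M) =
      Real.sin ((2 * m - 1) * α) + Real.sin α := by
    intro m
    induction m with
    | zero => simp
    | succ m ih =>
      rw [Finset.sum_range_succ, ih]
      have h1 : (m : ℝ) * j * Real.pi / M = 2 * m * α := by rw [hα]; field_simp
      have h2 : (2 * ((m + 1 : ℕ) : ℝ) - 1) * α = 2 * m * α + α := by push_cast; ring
      have h3 : (2 * (m : ℝ) - 1) * α = 2 * m * α - α := by ring
      rw [h1, h2, h3, Real.sin_add, Real.sin_sub]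
      ring
  have h := htel M
  rw [← Finset.mul_sum] at h
  have h4 : (2 * (M : ℝ) - 1) * α = j * Real.pi - α := by rw [hα]; field_simp
  rw [h4, Real.sin_sub, Real.sin_nat_mul_pi, Real.cos_nat_mul_pi] at h
  have : 2 * Real.sin α * (∑ k ∈ Finset.range M, Real.cos (k * j * Real.pi / M)
      - (1 - (-1) ^ j) / 2) = 0 := by linear_combination h
  have := (mul_eq_zero.mp this).resolve_left (by simpa using hs)
  linarith

/-- Spectral form of the number of walks of length `n` from `1` to `l` in the path graph
on the vertices `1, …, M - 1`. -/
noncomputable def pathWalk (M l n : ℕ) : ℝ :=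
  2 / M * ∑ k ∈ Finset.range M, Real.sin (k * Real.pi / M) * Real.sin (k * l * Real.pi / M) *
    (2 * Real.cos (k * Real.pi / M)) ^ n

lemma pathWalk_zero_left (M n : ℕ) : pathWalk M 0 n = 0 := by simp [pathWalk]

lemma pathWalk_self (M n : ℕ) : pathWalk M M n = 0 := by
  rcases Nat.eq_zero_or_pos M with rfl | hM
  · simp [pathWalk]
  · have hM : (M : ℝ) ≠ 0 := by positivity
    rw [pathWalk, Finset.sum_eq_zero, mul_zero]
    intro k _
    rw [show (k : ℝ) * M * Real.pi / M = k * Real.pi by field_simp, Real.sin_nat_mul_pi]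
    ring

lemma pathWalk_succ (M l n : ℕ) :
    pathWalk M (l + 1) (n + 1) = pathWalk M l n + pathWalk M (l + 2) n := by
  simp only [pathWalk]
  rw [← mul_add, ← Finset.sum_add_distrib]
  congr 1
  refine Finset.sum_congr rfl fun k _ => ?_
  set x : ℝ := k * (l + 1) * Real.pi / M with hx
  set y : ℝ := k * Real.pi / M with hy
  have h1 : (k : ℝ) * l * Real.pi / M = x - y := by rw [hx, hy]; ring
  have h2 : (k : ℝ) * (l + 2 : ℕ) * Real.pi / M = x + y := by rw [hx, hy]; push_cast; ring
  have h3 : (k : ℝ) * (l + 1 : ℕ) * Real.pi / M = x := by rw [hx]; push_cast; ring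
  rw [h1, h2, h3, Real.sin_add, Real.sin_sub]
  ring

lemma pathWalk_zero_right {M l : ℕ} (hM : 2 ≤ M) (hl : 0 < l) (hlM : l < M) :
    pathWalk M l 0 = if l = 1 then 1 else 0 := by
  have hM0 : (M : ℝ) ≠ 0 := by
    have : 0 < M := by omega
    positivity
  have key : pathWalk M l 0 = 1 / M * (∑ k ∈ Finset.range M, Real.cos (k * (l - 1 : ℕ) * Real.pi / M)
      - ∑ k ∈ Finset.range M, Real.cos (k * (l + 1 : ℕ) * Real.pi / M)) := by
    rw [pathWalk, ← Finset.sum_sub_distrib, Finset.mul_sum, Finset.mul_sum]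
    refine Finset.sum_congr rfl fun k _ => ?_
    rw [show (k : ℝ) * (l - 1 : ℕ) * Real.pi / M = k * l * Real.pi / M - k * Real.pi / M by
        rw [Nat.cast_sub hl]; push_cast; ring,
      show (k : ℝ) * (l + 1 : ℕ) * Real.pi / M = k * l * Real.pi / M + k * Real.pi / M by
        push_cast; ring, Real.cos_sub, Real.cos_add]
    ring
  rw [key, sum_range_cos_mul_pi_div (by omega : 0 < l + 1) (by omega)]
  -- For `l = 1` the first sum consists of ones. Otherwise `l - 1` and `l + 1` have the same parity
  -- and the two sums cancel.
  split_ifs with h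
  · subst h
    simp [hM0]
  · obtain ⟨l, rfl⟩ : ∃ l', l = l' + 1 := ⟨l - 1, by omega⟩
    rw [Nat.add_sub_cancel, sum_range_cos_mul_pi_div (by omega : 0 < l) (by omega)]
    ring

/-- Generating function of `pathWalk M l`. -/
noncomputable def pathWalkGF (M l : ℕ) : PowerSeries ℝ := PowerSeries.mk (pathWalk M l)

lemma pathWalkGF_succ {M l : ℕ} (hM : 2 ≤ M) (hlM : l + 1 < M) :
    pathWalkGF M (l + 1) =
      (if l = 0 then 1 else 0) + PowerSeries.X * (pathWalkGF M l + pathWalkGF M (l + 2)) := by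
  ext n
  rw [map_add]
  rcases n with _ | n
  · rw [pathWalkGF, PowerSeries.coeff_mk, pathWalk_zero_right hM (by omega) hlM]
    split_ifs <;> simp_all
  · rw [PowerSeries.coeff_succ_X_mul, map_add]
    simp only [pathWalkGF, PowerSeries.coeff_mk, pathWalk_succ]
    split_ifs <;> simp [PowerSeries.coeff_one]

/-- The three-term recurrence is solved downwards from the absorbing end `M`, where the series
vanishes; it is the recurrence of `fib`. -/
lemma pathWalkGF_mul_fib_aux {M j : ℕ} (hM : 2 ≤ M) (hj : j + 2 ≤ M) :
    PowerSeries.X ^ j * pathWalkGF M (M - 1 - j) = PlaneTree.fib j * pathWalkGF M (M - 1) := by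
  induction j using Nat.strong_induction_on with
  | _ j ih =>
    rcases j with _ | _ | j
    · simp [PlaneTree.fib]
    · have h := pathWalkGF_succ (M := M) (l := M - 2) hM (by omega)
      rw [if_neg (by omega), show M - 2 + 2 = M by omega, show M - 2 + 1 = M - 1 by omega] at h
      have h0 : pathWalkGF M M = 0 := by ext n; simp [pathWalkGF, pathWalk_self]
      rw [h0] at h
      rw [show M - 1 - (0 + 1) = M - 2 by omega, PlaneTree.fib, h]
      ring
    · have h := pathWalkGF_succ (M := M) (l := M - 1 - (j + 2)) hM (by omega)
      rw [if_neg (by omega), show M - 1 - (j + 2) + 1 = M - 1 - (j + 1) by omega,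
        show M - 1 - (j + 2) + 2 = M - 1 - j by omega] at h
      have h1 := ih j (by omega) (by omega)
      have h2 := ih (j + 1) (by omega) (by omega)
      rw [PlaneTree.fib]
      linear_combination h2 - PowerSeries.X ^ 2 * h1 - PowerSeries.X ^ (j + 1) * h

/-- The equation at the starting vertex, the only inhomogeneous one, fixes the constant left free by
the recurrence. -/
lemma pathWalkGF_mul_fib (m : ℕ) :
    pathWalkGF (m + 2) (m + 1) * PlaneTree.fib (m + 1) = PowerSeries.X ^ m := by
  have hU0 : pathWalkGF (m + 2) 0 = 0 := by ext n; simp [pathWalkGF, pathWalk_zero_left]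
  have h1 := pathWalkGF_mul_fib_aux (M := m + 2) (j := m) (by omega) (by omega)
  have h := pathWalkGF_succ (M := m + 2) (l := 0) (by omega) (by omega)
  rw [show m + 2 - 1 - m = 1 by omega, show m + 2 - 1 = m + 1 by omega] at h1
  rw [if_pos rfl, hU0, zero_add, zero_add, zero_add] at h
  rcases m with _ | m
  · have hU : pathWalkGF (0 + 2) 2 = 0 := by ext n; simp [pathWalkGF, pathWalk_self]
    rw [hU] at h
    simp [PlaneTree.fib, h]
  · have h2 := pathWalkGF_mul_fib_aux (M := m + 3) (j := m) (by omega) (by omega)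
    rw [show m + 3 - 1 - m = 2 by omega, show m + 3 - 1 = m + 2 by omega] at h2
    rw [PlaneTree.fib]
    linear_combination -h1 + PowerSeries.X ^ 2 * h2 + PowerSeries.X ^ (m + 1) * h

lemma fib_ne_zero (m : ℕ) : PlaneTree.fib (m + 1) ≠ 0 := by
  intro h
  have := pathWalkGF_mul_fib m
  rw [h, mul_zero] at this
  exact pow_ne_zero _ PowerSeries.X_ne_zero this.symm

lemma numOneSided_eq_pathWalk {m N : ℕ} (h : m ≤ N) :
    (numOneSided (m + 1) (N + 1) : ℝ) = pathWalk (m + 2) (m + 1) (2 * N - m) := by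
  have key : PlaneTree.gf (PlaneTree.leftHigh m) =
      PowerSeries.X ^ m * pathWalkGF (m + 2) (m + 1) := by
    apply mul_right_cancel₀ (fib_ne_zero m)
    rw [PlaneTree.gf_leftHigh_mul_fib, mul_assoc, pathWalkGF_mul_fib]
    ring
  rw [← coeff_gf_leftHigh, key, PowerSeries.coeff_X_pow_mul', if_pos (by omega), pathWalkGF,
    PowerSeries.coeff_mk]

/-- Spectral form of the number of one-sided trees. -/
lemma numOneSided_eq_sum {m N : ℕ} (h : m ≤ N) :
    (numOneSided (m + 1) (N + 1) : ℝ) = 2 / (m + 2 : ℕ) * ∑ k ∈ Finset.range (m + 2),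
      (-1) ^ (k + 1) * Real.sin (k * Real.pi / (m + 2 : ℕ)) ^ 2 *
        (2 * Real.cos (k * Real.pi / (m + 2 : ℕ))) ^ (2 * N - m) := by
  rw [numOneSided_eq_pathWalk h, pathWalk]
  congr 1
  refine Finset.sum_congr rfl fun k _ => ?_
  have hM : ((m + 2 : ℕ) : ℝ) ≠ 0 := by positivity
  have : (k : ℝ) * (m + 1 : ℕ) * Real.pi / (m + 2 : ℕ) =
      k * Real.pi - k * Real.pi / (m + 2 : ℕ) := by
    field_simp
    push_cast
    ring
  rw [this, Real.sin_sub, Real.sin_nat_mul_pi, Real.cos_nat_mul_pi]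
  ring

/-! ### Gaussian bounds for the cosine -/

/-- The product of `cos y` and `exp (y ^ 2 / 2)` decreases because `y < tan y`. -/
lemma Real.cos_le_exp_neg_sq_div_two {x : ℝ} (h0 : 0 ≤ x) (h1 : x ≤ Real.pi / 2) :
    Real.cos x ≤ Real.exp (-x ^ 2 / 2) := by
  have hanti : AntitoneOn (fun y : ℝ => Real.cos y * Real.exp (y ^ 2 / 2))
      (Set.Icc 0 (Real.pi / 2)) := by
    have hder : ∀ y : ℝ, HasDerivAt (fun y : ℝ => Real.cos y * Real.exp (y ^ 2 / 2))
        (-Real.sin y * Real.exp (y ^ 2 / 2) +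
          Real.cos y * (Real.exp (y ^ 2 / 2) * (2 * y / 2))) y := by
      intro y
      have h2 : HasDerivAt (fun y : ℝ => y ^ 2 / 2) (2 * y / 2) y := by
        simpa using (hasDerivAt_pow 2 y).div_const 2
      exact (Real.hasDerivAt_cos y).mul h2.exp
    refine antitoneOn_of_deriv_nonpos (convex_Icc _ _) (by fun_prop)
      (fun y _ => (hder y).differentiableAt.differentiableWithinAt) ?_
    intro y hy
    rw [interior_Icc] at hy
    rw [(hder y).deriv]
    have hc : 0 < Real.cos y := Real.cos_pos_of_mem_Ioo ⟨by linarith [hy.1, Real.pi_pos], hy.2⟩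
    have ht := Real.lt_tan hy.1 hy.2
    rw [Real.tan_eq_sin_div_cos, lt_div_iff₀ hc] at ht
    have he := Real.exp_pos (y ^ 2 / 2)
    nlinarith
  have h := hanti ⟨le_rfl, by linarith [Real.pi_pos]⟩ ⟨h0, h1⟩ h0
  simp only [Real.cos_zero, ne_eq, OfNat.ofNat_ne_zero, not_false_eq_true, zero_pow, zero_div,
    Real.exp_zero, mul_one] at h
  rw [neg_div, Real.exp_neg, ← one_div, le_div_iff₀ (Real.exp_pos _)]
  exact h

/-- Combines `1 + u ≤ exp u` with (1 - x²/2)(1 + x²/2 + x⁴) ≥ 1 for |x| ≤ 1. -/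
lemma Real.exp_neg_le_cos {x : ℝ} (h : |x| ≤ 1) :
    Real.exp (-(x ^ 2 / 2 + x ^ 4)) ≤ Real.cos x := by
  have hx : x ^ 2 ≤ 1 := by rw [← sq_abs]; nlinarith [abs_nonneg x]
  have h1 := Real.one_sub_sq_div_two_le_cos (x := x)
  have h2 := Real.add_one_le_exp (x ^ 2 / 2 + x ^ 4)
  refine le_trans ?_ h1
  rw [Real.exp_neg, inv_le_comm₀ (Real.exp_pos _) (by linarith)]
  refine le_trans ?_ h2
  rw [inv_le_iff_one_le_mul₀ (by linarith)]
  nlinarith [sq_nonneg x, mul_nonneg (sq_nonneg x) (sq_nonneg x), mul_nonneg (mul_nonneg (sq_nonneg x) (sq_nonneg x)) (sub_nonneg.2 hx)]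

/-! ### Gaussian sums by Poisson summation -/

/-- In the theta series the nonzero frequencies are dominated by a two-sided geometric series, since
n² ≥ |n|; the phase depending on `a` has modulus one. -/
lemma abs_cosKernel_sub_one_le (a : ℝ) {t : ℝ} (ht : 0 < t) :
    |HurwitzZeta.cosKernel a t - 1| ≤ 2 * ((Real.exp (Real.pi * t) - 1)⁻¹) := by
  have h := (HurwitzZeta.hasSum_int_cosKernel a ht)
  have h2 := h.sub (hasSum_ite_eq (0 : ℤ) (1 : ℂ))
  set r := Real.exp (-Real.pi * t) with hr
  have hr0 : 0 < r := Real.exp_pos _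
  have hr1 : r < 1 := by
    rw [hr, Real.exp_lt_one_iff]
    nlinarith [Real.pi_pos]
  have hgeo : HasSum (fun n : ℕ => r ^ (n + 1)) (r * (1 - r)⁻¹) := by
    simpa [pow_succ'] using (hasSum_geometric_of_lt_one hr0.le hr1).mul_left r
  have hbd : HasSum (fun n : ℤ => if n = 0 then 0 else r ^ n.natAbs)
      (r * (1 - r)⁻¹ + r * (1 - r)⁻¹) := by
    refine HasSum.of_nat_of_neg_add_one ?_ ?_
    · rw [← hasSum_nat_add_iff' 1]
      simp only [Finset.range_one, Finset.sum_singleton, Nat.cast_zero, if_true, sub_zero]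
      refine HasSum.congr_fun hgeo fun n => ?_
      rw [if_neg (by omega)]
      congr 1
    · convert hgeo using 2 with n
      rw [if_neg (by omega)]
      congr 1
  have hle := tsum_of_norm_bounded (f := fun n : ℤ =>
    Complex.exp (2 * Real.pi * Complex.I * a * n) * Real.exp (-Real.pi * n ^ 2 * t) -
      if n = 0 then 1 else 0) hbd (by
    intro n
    split_ifs with hn
    · subst hn; simp
    · rw [sub_zero, norm_mul]
      have h1 : ‖Complex.exp (2 * Real.pi * Complex.I * a * n)‖ = 1 := by
        rw [show (2 * Real.pi * Complex.I * a * n : ℂ) = ((2 * Real.pi * a * n : ℝ) : ℂ) * Complex.I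
          by push_cast; ring, Complex.norm_exp_ofReal_mul_I]
      rw [h1, one_mul, Complex.norm_real, Real.norm_of_nonneg (Real.exp_pos _).le, hr,
        ← Real.exp_nat_mul, Real.exp_le_exp]
      have h2 : (n.natAbs : ℝ) ≤ (n : ℝ) ^ 2 := by
        rw [← sq_abs, ← Int.cast_abs, Int.abs_eq_natAbs, Int.cast_natCast]
        have : (1 : ℝ) ≤ n.natAbs := by exact_mod_cast Int.natAbs_pos.2 hn
        nlinarith
      have := mul_pos Real.pi_pos ht
      nlinarith)
  rw [h2.tsum_eq] at hle
  have he : r * (1 - r)⁻¹ = (Real.exp (Real.pi * t) - 1)⁻¹ := by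
    rw [← div_eq_mul_inv, show Real.exp (Real.pi * t) = r⁻¹ by rw [hr, ← Real.exp_neg]; ring_nf]
    have : (1 - r) ≠ 0 := by linarith
    field_simp
  rw [he] at hle
  have : ((HurwitzZeta.cosKernel a t - 1 : ℝ) : ℂ) = HurwitzZeta.cosKernel a t - 1 := by simp
  rw [← Real.norm_eq_abs, ← Complex.norm_real, this]
  linarith

/-- Discrete Gaussian sums approximate the Gaussian integral, uniformly in the centre. -/
lemma exists_gaussian_sum_bound {κ : ℝ} (hκ : 0 < κ) : ∃ C : ℝ, 0 ≤ C ∧ ∀ a L : ℝ, 1 ≤ L →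
    Summable (fun n : ℤ => Real.exp (-κ * (n - a) ^ 2 / L)) ∧
      |∑' n : ℤ, Real.exp (-κ * (n - a) ^ 2 / L) - Real.sqrt (Real.pi * L / κ)| ≤ C := by
  have hπ := Real.pi_pos
  refine ⟨2 * Real.sqrt (Real.pi / κ) * (κ / Real.pi ^ 2), by positivity, fun a L hL => ?_⟩
  have hL0 : 0 < L := by linarith
  set t := κ / (Real.pi * L) with ht
  have ht0 : 0 < t := by positivity
  have h := HurwitzZeta.hasSum_int_evenKernel (-a) ht0
  have he : ∀ n : ℤ, Real.exp (-Real.pi * (n + -a) ^ 2 * t) = Real.exp (-κ * (n - a) ^ 2 / L) := by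
    intro n
    congr 1
    rw [ht]
    field_simp
    ring
  simp_rw [he] at h
  refine ⟨h.summable, ?_⟩
  -- Poisson summation: the zero frequency gives the integral. The others are exponentially small in
  -- `L`; a bound of order `1 / L` suffices against the factor √L.
  rw [h.tsum_eq, HurwitzZeta.evenKernel_functional_equation]
  have hs : 1 / t ^ (1 / 2 : ℝ) = Real.sqrt (Real.pi * L / κ) := by
    rw [← Real.sqrt_eq_rpow, one_div, ← Real.sqrt_inv, ht, inv_div]
  have hc := abs_cosKernel_sub_one_le (-a) (one_div_pos.2 ht0)
  rw [hs, ← mul_sub_one, abs_mul, abs_of_nonneg (Real.sqrt_nonneg _)]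
  have h1t : Real.pi * (1 / t) = Real.pi ^ 2 * L / κ := by rw [ht]; field_simp
  rw [h1t] at hc
  have hq : (Real.exp (Real.pi ^ 2 * L / κ) - 1)⁻¹ ≤ κ / Real.pi ^ 2 * L⁻¹ := by
    rw [inv_le_comm₀]
    · have := Real.add_one_le_exp (Real.pi ^ 2 * L / κ)
      rw [mul_inv, inv_inv, inv_div]
      have h3 : Real.pi ^ 2 / κ * L = Real.pi ^ 2 * L / κ := by ring
      linarith
    · have := Real.add_one_lt_exp (x := Real.pi ^ 2 * L / κ) (by positivity)
      have : 0 < Real.pi ^ 2 * L / κ := by positivity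
      linarith
    · positivity
  have hsq : Real.sqrt (Real.pi * L / κ) = Real.sqrt (Real.pi / κ) * Real.sqrt L := by
    rw [← Real.sqrt_mul (by positivity)]
    congr 1
    ring
  have hLL : Real.sqrt L * L⁻¹ ≤ 1 := by
    rw [← div_eq_mul_inv, div_le_one hL0]
    exact Real.sqrt_le_self_iff.2 (Or.inr hL)
  calc Real.sqrt (Real.pi * L / κ) * |HurwitzZeta.cosKernel (-a : ℝ) (1 / t) - 1|
      ≤ Real.sqrt (Real.pi * L / κ) * (2 * (κ / Real.pi ^ 2 * L⁻¹)) := by gcongr; linarith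
    _ = 2 * Real.sqrt (Real.pi / κ) * (κ / Real.pi ^ 2) * (Real.sqrt L * L⁻¹) := by rw [hsq]; ring
    _ ≤ _ := mul_le_of_le_one_right (by positivity) hLL

/-- One-sided version of `exists_gaussian_sum_bound`. -/
lemma exists_gaussian_nat_sum_bound {κ : ℝ} (hκ : 0 < κ) : ∃ C : ℝ, 0 ≤ C ∧ ∀ L : ℝ, 2 ≤ L →
    Summable (fun k : ℕ => Real.exp (-κ * ((k + 2 : ℕ) - L) ^ 2 / L)) ∧
      |∑' k : ℕ, Real.exp (-κ * ((k + 2 : ℕ) - L) ^ 2 / L) - Real.sqrt (Real.pi * L / κ)| ≤ C := by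
  obtain ⟨C, hC, h⟩ := exists_gaussian_sum_bound hκ
  set r := Real.exp (-κ) with hr
  have hr1 : r < 1 := by rw [hr, Real.exp_lt_one_iff]; linarith
  have hr0 : 0 < r := Real.exp_pos _
  refine ⟨C + (1 - r)⁻¹, by have := inv_nonneg.2 (sub_nonneg.2 hr1.le); positivity, fun L hL => ?_⟩
  -- The centre is shifted so that index `k` stands for the integer `k + 2`; the integers below 2
  -- are then discarded at bounded cost.
  obtain ⟨hsum, hle⟩ := h (L - 2) L (by linarith)
  have e1 : ∀ k : ℕ, Real.exp (-κ * (((k : ℕ) : ℤ) - (L - 2)) ^ 2 / L) =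
      Real.exp (-κ * ((k + 2 : ℕ) - L) ^ 2 / L) := by
    intro k; push_cast; congr 3; ring
  have hs1 : Summable (fun k : ℕ => Real.exp (-κ * ((k + 2 : ℕ) - L) ^ 2 / L)) := by
    have := hsum.comp_injective Nat.cast_injective
    refine this.congr fun k => ?_
    simp only [Function.comp]
    exact_mod_cast e1 k
  have hneg : ∀ k : ℕ, Real.exp (-κ * (((-(k + 1) : ℤ) : ℝ) - (L - 2)) ^ 2 / L) ≤ r ^ k := by
    intro k
    rw [hr, ← Real.exp_nat_mul, Real.exp_le_exp, div_le_iff₀ (by linarith)]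
    push_cast
    have hk : (0 : ℝ) ≤ k := Nat.cast_nonneg k
    have : (k : ℝ) * L ≤ (-(k + 1) - (L - 2)) ^ 2 := by nlinarith
    nlinarith
  have hs2 : Summable (fun k : ℕ => Real.exp (-κ * (((-(k + 1) : ℤ) : ℝ) - (L - 2)) ^ 2 / L)) :=
    (summable_geometric_of_lt_one hr0.le hr1).of_nonneg_of_le (fun _ => (Real.exp_pos _).le) hneg
  refine ⟨hs1, ?_⟩
  have hb := hs2.tsum_le_tsum hneg (summable_geometric_of_lt_one hr0.le hr1)
  rw [tsum_geometric_of_lt_one hr0.le hr1] at hb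
  have hb0 : 0 ≤ ∑' k : ℕ, Real.exp (-κ * (((-(k + 1) : ℤ) : ℝ) - (L - 2)) ^ 2 / L) :=
    tsum_nonneg fun _ => (Real.exp_pos _).le
  have hsplit := tsum_of_nat_of_neg_add_one
    (f := fun n : ℤ => Real.exp (-κ * ((n : ℝ) - (L - 2)) ^ 2 / L))
    (hs1.congr fun k => (by exact_mod_cast (e1 k).symm)) hs2
  rw [hsplit] at hle
  have e2 : ∑' k : ℕ, Real.exp (-κ * ((((k : ℕ) : ℤ) : ℝ) - (L - 2)) ^ 2 / L) =
      ∑' k : ℕ, Real.exp (-κ * ((k + 2 : ℕ) - L) ^ 2 / L) :=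
    tsum_congr fun k => by exact_mod_cast e1 k
  rw [e2] at hle
  rw [abs_le] at hle ⊢
  constructor <;> linarith [hle.1, hle.2]

/-! ### Dominance of the two extreme eigenvalues -/

/-- The alternating trigonometric sum in the spectral form of `numOneSided`. -/
noncomputable def spectralSum (n e : ℕ) : ℝ :=
  ∑ k ∈ Finset.range n, (-1) ^ (k + 1) * Real.sin (k * Real.pi / n) ^ 2 *
    Real.cos (k * Real.pi / n) ^ e

/-- The reflection k ↦ n - k reduces to angles at most π/2, where the angle is at least 2π/n. The
decay rate is four times that of the leading term. -/
lemma abs_cos_le_exp {n k : ℕ} (hk : 2 ≤ k) (hkn : k + 2 ≤ n) :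
    |Real.cos (k * Real.pi / n)| ≤ Real.exp (-(2 * Real.pi ^ 2 / n ^ 2)) := by
  have hπ := Real.pi_pos
  have hn : (0 : ℝ) < n := by exact_mod_cast (by omega : 0 < n)
  have key : ∀ j : ℕ, 2 ≤ j → (j : ℝ) * Real.pi / n ≤ Real.pi / 2 →
      |Real.cos (j * Real.pi / n)| ≤ Real.exp (-(2 * Real.pi ^ 2 / n ^ 2)) := by
    intro j hj hle
    have h0 : (0 : ℝ) ≤ j * Real.pi / n := by positivity
    rw [abs_of_nonneg (Real.cos_nonneg_of_mem_Icc ⟨by linarith, hle⟩)]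
    refine (Real.cos_le_exp_neg_sq_div_two h0 hle).trans (Real.exp_le_exp.2 ?_)
    have hj' : (2 : ℝ) ≤ j := by exact_mod_cast hj
    have : 2 * Real.pi / n ≤ j * Real.pi / n := by gcongr
    have h2 : (2 * Real.pi / n) ^ 2 ≤ (j * Real.pi / n) ^ 2 := by gcongr
    have h3 : (2 * Real.pi / n) ^ 2 = 2 * (2 * Real.pi ^ 2 / n ^ 2) := by ring
    linarith
  rcases le_total ((k : ℝ) * Real.pi / n) (Real.pi / 2) with h | h
  · exact key k hk h
  · have e : (k : ℝ) * Real.pi / n = Real.pi - ((n - k : ℕ) : ℝ) * Real.pi / n := by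
      rw [Nat.cast_sub (by omega)]
      field_simp
      ring
    rw [e] at h ⊢
    rw [Real.cos_pi_sub, abs_neg]
    exact key (n - k) (by omega) (by linarith)

/-- The spectral sum is dominated by the two extreme eigenvalues. -/
lemma abs_spectralSum_sub_le {n e : ℕ} (hn : 2 ≤ n) (he : 1 ≤ e) (hp : Even (n + e)) :
    |spectralSum n e - 2 * Real.sin (Real.pi / n) ^ 2 * Real.cos (Real.pi / n) ^ e| ≤
      n * Real.exp (-(2 * Real.pi ^ 2 / n ^ 2) * e) := by
  have hn0 : (n : ℝ) ≠ 0 := by have : 0 < n := by omega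
                               positivity
  rcases hn.eq_or_lt with rfl | hn3
  -- For `n = 2` the indices 1 and n - 1 coincide, but the cosine vanishes and `e ≥ 1`.
  · have : Real.cos (Real.pi / (2 : ℕ)) = 0 := by simp
    rw [spectralSum, Finset.sum_range_succ, Finset.sum_range_one, this, zero_pow (by omega)]
    simp only [Nat.cast_zero, Nat.cast_one, one_mul, this, zero_pow (by omega : e ≠ 0), zero_mul,
      zero_div, Real.sin_zero, mul_zero, ne_eq, OfNat.ofNat_ne_zero, not_false_eq_true, zero_pow,
      sub_zero, add_zero, abs_zero]
    positivity
  set f : ℕ → ℝ := fun k => (-1) ^ (k + 1) * Real.sin (k * Real.pi / n) ^ 2 *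
    Real.cos (k * Real.pi / n) ^ e with hf
  have hsub : ({1, n - 1} : Finset ℕ) ⊆ Finset.range n := by
    intro k hk
    simp only [Finset.mem_insert, Finset.mem_singleton] at hk
    rw [Finset.mem_range]
    omega
  have h1 : f 1 = Real.sin (Real.pi / n) ^ 2 * Real.cos (Real.pi / n) ^ e := by
    simp [hf]
  have h2 : f (n - 1) = Real.sin (Real.pi / n) ^ 2 * Real.cos (Real.pi / n) ^ e := by
    have e1 : ((n - 1 : ℕ) : ℝ) * Real.pi / n = Real.pi - Real.pi / n := by
      rw [Nat.cast_sub (by omega)]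
      field_simp
      simp
    simp only [hf]
    rw [e1, Real.sin_pi_sub, Real.cos_pi_sub, neg_pow (Real.cos _), show n - 1 + 1 = n by omega]
    -- The parity hypothesis makes the two extreme terms add up instead of cancelling.
    have : (-1 : ℝ) ^ n * (-1) ^ e = 1 := by rw [← pow_add]; exact hp.neg_one_pow
    linear_combination Real.sin (Real.pi / n) ^ 2 * Real.cos (Real.pi / n) ^ e * this
  have hsplit := Finset.sum_sdiff (f := f) hsub
  rw [Finset.sum_pair (by omega), h1, h2] at hsplit
  have hS : spectralSum n e - 2 * Real.sin (Real.pi / n) ^ 2 * Real.cos (Real.pi / n) ^ e =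
      ∑ k ∈ Finset.range n \ {1, n - 1}, f k := by
    rw [spectralSum]
    linarith [hsplit]
  rw [hS]
  have hb : ∀ k ∈ Finset.range n \ {1, n - 1},
      |f k| ≤ Real.exp (-(2 * Real.pi ^ 2 / n ^ 2) * e) := by
    intro k hk
    simp only [Finset.mem_sdiff, Finset.mem_range, Finset.mem_insert, Finset.mem_singleton,
      not_or] at hk
    rcases Nat.eq_zero_or_pos k with rfl | hk0
    · simp [hf, (Real.exp_pos _).le]
    · have hc := abs_cos_le_exp (n := n) (k := k) (by omega) (by omega)
      have hs : |Real.sin (k * Real.pi / n)| ^ 2 ≤ 1 :=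
        pow_le_one₀ (abs_nonneg _) (Real.abs_sin_le_one _)
      simp only [hf]
      rw [abs_mul, abs_mul, abs_pow, abs_neg, abs_one, one_pow, one_mul, abs_pow, abs_pow,
        mul_comm (-(2 * Real.pi ^ 2 / (n : ℝ) ^ 2)), Real.exp_nat_mul]
      calc _ ≤ 1 * Real.exp (-(2 * Real.pi ^ 2 / n ^ 2)) ^ e := by gcongr
        _ = _ := one_mul _
  calc |∑ k ∈ Finset.range n \ {1, n - 1}, f k|
      ≤ ∑ k ∈ Finset.range n \ {1, n - 1}, |f k| := Finset.abs_sum_le_sum_abs _ _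
    _ ≤ (Finset.range n \ {1, n - 1}).card • Real.exp (-(2 * Real.pi ^ 2 / n ^ 2) * e) :=
        Finset.sum_le_card_nsmul _ _ _ hb
    _ ≤ n * Real.exp (-(2 * Real.pi ^ 2 / n ^ 2) * e) := by
        rw [nsmul_eq_mul]
        have : (Finset.range n \ {1, n - 1}).card ≤ n :=
          (Finset.card_le_card Finset.sdiff_subset).trans_eq (Finset.card_range n)
        gcongr

/-! ### Elementary estimates around the saddle point -/

lemma cube_mul_exp_neg_le {κ L : ℝ} (hκ : 0 < κ) (hL : 0 ≤ L) :
    L ^ 3 * Real.exp (-(κ * L)) ≤ 6 / κ ^ 3 := by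
  have h := Real.pow_div_factorial_le_exp (x := κ * L) (by positivity) 3
  rw [Real.exp_neg, ← div_eq_mul_inv, div_le_div_iff₀ (Real.exp_pos _) (by positivity)]
  have : (Nat.factorial 3 : ℝ) = 6 := by norm_num [Nat.factorial]
  rw [this, div_le_iff₀ (by norm_num), mul_pow] at h
  linarith

lemma poly_mul_exp_neg_sq_le {κ w : ℝ} (hκ : 0 < κ) :
    (1 + w + w ^ 3) * Real.exp (-(κ * w ^ 2)) ≤ 3 + 6 / κ ^ 2 := by
  have h := Real.quadratic_le_exp_of_nonneg (x := κ * w ^ 2) (by positivity)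
  rw [Real.exp_neg, ← div_eq_mul_inv, div_le_iff₀ (Real.exp_pos _)]
  have h1 : 1 + w + w ^ 3 ≤ 3 + 3 * w ^ 4 := by
    nlinarith [sq_nonneg (w - 1), sq_nonneg (w ^ 2 - 1), sq_nonneg (w ^ 2 - w), sq_nonneg w]
  have h2 : (3 + 6 / κ ^ 2) * (1 + κ * w ^ 2 + (κ * w ^ 2) ^ 2 / 2) ≤
      (3 + 6 / κ ^ 2) * Real.exp (κ * w ^ 2) := by gcongr
  refine le_trans (h1.trans ?_) h2
  have h3 : (3 + 6 / κ ^ 2) * (1 + κ * w ^ 2 + (κ * w ^ 2) ^ 2 / 2) =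
      3 + 3 * w ^ 4 + (3 * κ * w ^ 2 + 3 * κ ^ 2 * w ^ 4 / 2 + 6 / κ ^ 2 + 6 / κ * w ^ 2) := by
    field_simp
    ring
  rw [h3]
  have : 0 ≤ 3 * κ * w ^ 2 + 3 * κ ^ 2 * w ^ 4 / 2 + 6 / κ ^ 2 + 6 / κ * w ^ 2 := by positivity
  linarith

lemma abs_exp_neg_sub_exp_neg_le {u v m : ℝ} (hu : m ≤ u) (hv : m ≤ v) :
    |Real.exp (-u) - Real.exp (-v)| ≤ |u - v| * Real.exp (-m) := by
  wlog h : u ≤ v generalizing u v with H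
  · rw [abs_sub_comm, abs_sub_comm u]
    exact H hv hu (not_le.1 h).le
  · have h1 := Real.add_one_le_exp (u - v)
    have h2 : Real.exp (-v) = Real.exp (-u) * Real.exp (u - v) := by rw [← Real.exp_add]; ring_nf
    have h3 : Real.exp (-v) ≤ Real.exp (-u) := Real.exp_le_exp.2 (by linarith)
    have h4 : Real.exp (-u) ≤ Real.exp (-m) := Real.exp_le_exp.2 (by linarith)
    rw [abs_of_nonneg (by linarith), abs_of_nonpos (by linarith)]
    have h5 : Real.exp (-u) * (u - v + 1) ≤ Real.exp (-v) := by rw [h2]; gcongr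
    have h6 : Real.exp (-u) * -(u - v) ≤ Real.exp (-m) * -(u - v) := by
      gcongr
      linarith
    linarith

/-- The exponent is at its saddle point `y = L`. -/
lemma exponent_identity {y L : ℝ} (hy : y ≠ 0) :
    y + L ^ 3 / (2 * y ^ 2) - 3 * L / 2 = (y - L) ^ 2 * (2 * y + L) / (2 * y ^ 2) := by
  field_simp
  ring

lemma far_bound {y L : ℝ} (hL : 0 < L) (hy : 0 ≤ y) (hfar : L / 2 < |y - L|) :
    (y + L) * max y L ≤ 20 * (y - L) ^ 2 := by
  have h : L / 2 < y - L ∨ y - L < -(L / 2) := by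
    rcases lt_abs.1 hfar with h | h
    · exact Or.inl h
    · exact Or.inr (by linarith)
  rcases h with h | h
  · rw [max_eq_left (by linarith)]
    nlinarith
  · rw [max_eq_right (by linarith)]
    nlinarith

lemma gaussian_far {c y L : ℝ} (hc : 0 < c) (hL : 0 < L) (hy : 0 ≤ y) (hfar : L / 2 < |y - L|) :
    Real.exp (-(3 * c / 2) * (y - L) ^ 2 / L) ≤ Real.exp (-(c / 20) * y) := by
  rw [Real.exp_le_exp, div_le_iff₀ hL]
  have h := far_bound hL hy hfar
  have h2 : (y + L) * L ≤ (y + L) * max y L := by gcongr; exact le_max_right _ _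
  have h3 : y * L ≤ 20 * (y - L) ^ 2 := by nlinarith
  nlinarith [mul_le_mul_of_nonneg_left h3 hc.le, mul_nonneg hc.le (sq_nonneg (y - L))]

lemma exponent_far {y L : ℝ} (hL : 0 < L) (hy : 0 < y) (hfar : L / 2 < |y - L|) :
    (y + L) / 20 ≤ y + L ^ 3 / (2 * y ^ 2) - 3 * L / 2 := by
  rw [exponent_identity hy.ne', le_div_iff₀ (by positivity)]
  have h := far_bound hL hy.le hfar
  have h2 : (y + L) * y ≤ (y + L) * max y L := by gcongr; exact le_max_left _ _
  have h3 : (y + L) * y ≤ 20 * (y - L) ^ 2 := h2.trans h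
  have h4 : (y + L) * y * y ≤ 20 * (y - L) ^ 2 * y := by gcongr
  have h5 : 0 ≤ (y - L) ^ 2 * L := by positivity
  linarith

/-- With the second term quadrupled, the minimum rises from 3L/2 to 4^{1/3} · 3L/2, which leaves
room for a linear gain. -/
lemma exponent_double {y L : ℝ} (hL : 0 < L) (hy : 0 < y) :
    (y + L) / 10 ≤ y + 2 * L ^ 3 / y ^ 2 - 3 * L / 2 := by
  have h : y + 2 * L ^ 3 / y ^ 2 - 3 * L / 2 - (y + L) / 10 =
      (9 * y ^ 3 - 16 * L * y ^ 2 + 20 * L ^ 3) / (10 * y ^ 2) := by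
    field_simp
    ring
  have h2 : 0 ≤ 9 * y ^ 3 - 16 * L * y ^ 2 + 20 * L ^ 3 := by
    have h3 := mul_nonneg (by linarith : 0 ≤ 9 * y + 6 * L) (sq_nonneg (y - 5 / 4 * L))
    have h4 := mul_nonneg hL.le (sq_nonneg (y - L))
    have h5 := mul_nonneg hL.le (sq_nonneg (2 * y - L))
    nlinarith [pow_pos hL 3, mul_pos hL (pow_pos hy 2), mul_pos (pow_pos hL 2) hy]
  have := div_nonneg h2 (by positivity : 0 ≤ 10 * y ^ 2)
  linarith

/-- With x = π/y the prefactor is (L/y)³ (sin x / x)²; the first factor gives the error |y - L|/L,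
the second 1/L. -/
lemma abs_prefactor_sub_one_le {y L : ℝ} (hL : 10 ≤ L) (hy : L / 2 ≤ y) :
    |L ^ 3 / (Real.pi ^ 2 * y) * Real.sin (Real.pi / y) ^ 2 - 1| ≤ 14 * |y - L| / L + 16 / L := by
  have hπ := Real.pi_pos
  have hπ4 := Real.pi_lt_d2
  have hL0 : 0 < L := by linarith
  have hy0 : 0 < y := by linarith
  set x := Real.pi / y with hx
  have hx0 : 0 < x := by positivity
  have hx1 : x ≤ 1 := by rw [hx, div_le_one hy0]; linarith
  have hs1 : Real.sin x ≤ x := Real.sin_le hx0.le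
  have hs2 := Real.sin_gt_sub_cube hx0
  set q := Real.sin x ^ 2 / x ^ 2 with hq
  have hs0 : 0 ≤ x - x ^ 3 / 4 := by nlinarith [pow_pos hx0 2]
  have hq1 : q ≤ 1 := by
    rw [hq, div_le_one (by positivity)]
    have : 0 ≤ Real.sin x := by linarith
    gcongr
  have hq2 : 1 - x ^ 2 / 2 ≤ q := by
    rw [hq, le_div_iff₀ (by positivity)]
    have h1 : (x - x ^ 3 / 4) ^ 2 ≤ Real.sin x ^ 2 := by
      gcongr
      linarith [pow_pos hx0 3]
    nlinarith [pow_pos hx0 6]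
  have e : L ^ 3 / (Real.pi ^ 2 * y) * Real.sin x ^ 2 = L ^ 3 / y ^ 3 * q := by
    rw [hq, hx]; field_simp
  have hyL : L ^ 3 / y ^ 3 ≤ 8 := by
    rw [div_le_iff₀ (by positivity)]
    have : L ^ 3 ≤ (2 * y) ^ 3 := by gcongr; linarith
    nlinarith
  have hx2 : x ^ 2 ≤ 4 * Real.pi ^ 2 / L ^ 2 := by
    have : x ≤ 2 * Real.pi / L := by
      rw [hx, div_le_div_iff₀ hy0 hL0]; nlinarith
    calc x ^ 2 ≤ (2 * Real.pi / L) ^ 2 := by gcongr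
      _ = _ := by ring
  have hxL : x ^ 2 ≤ 4 / L := by
    refine hx2.trans ?_
    rw [div_le_div_iff₀ (by positivity) hL0]
    have : Real.pi ^ 2 ≤ L := by nlinarith
    nlinarith [mul_le_mul_of_nonneg_right this (by positivity : 0 ≤ 4 * L)]
  have h1 : |L ^ 3 / y ^ 3 * (q - 1)| ≤ 16 / L := by
    rw [abs_mul, abs_of_pos (by positivity : 0 < L ^ 3 / y ^ 3), abs_of_nonpos (by linarith)]
    calc L ^ 3 / y ^ 3 * -(q - 1) ≤ 8 * (x ^ 2 / 2) := by
          gcongr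
          · linarith
          · linarith
      _ ≤ 8 * (4 / L / 2) := by gcongr
      _ = 16 / L := by ring
  have h2 : |L ^ 3 / y ^ 3 - 1| ≤ 14 * |y - L| / L := by
    have e2 : L ^ 3 / y ^ 3 - 1 = (L - y) * ((L ^ 2 + L * y + y ^ 2) / y ^ 3) := by
      field_simp
      ring
    rw [e2, abs_mul, abs_sub_comm, abs_of_pos (by positivity :
      0 < (L ^ 2 + L * y + y ^ 2) / y ^ 3)]
    have : (L ^ 2 + L * y + y ^ 2) / y ^ 3 ≤ 14 / L := by
      rw [div_le_div_iff₀ (by positivity) hL0]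
      have a1 : L ^ 3 ≤ (2 * y) ^ 3 := by gcongr; linarith
      have a2 : L ^ 2 ≤ (2 * y) ^ 2 := by gcongr; linarith
      nlinarith
    calc |y - L| * ((L ^ 2 + L * y + y ^ 2) / y ^ 3) ≤ |y - L| * (14 / L) := by gcongr
      _ = _ := by ring
  rw [e, show L ^ 3 / y ^ 3 * q - 1 = (L ^ 3 / y ^ 3 - 1) + L ^ 3 / y ^ 3 * (q - 1) by ring]
  exact (abs_add_le _ _).trans (add_le_add h2 h1)

/-- `R` will be the power of the cosine divided by its Gaussian approximation exp(-π²N/y²). -/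
lemma abs_correction_sub_one_le {c y L R : ℝ} (hc : 0 < c) (hL : 10 ≤ L) (hy : L / 2 ≤ y)
    (hR1 : Real.exp (-(c * Real.pi ^ 2 * L ^ 3 / y ^ 4)) ≤ R)
    (hR2 : R ≤ Real.exp (Real.pi ^ 2 / (2 * y))) :
    |R - 1| ≤ (20 + 160 * c) / L := by
  have hπ := Real.pi_pos
  have hπ4 := Real.pi_lt_d2
  have hπ10 : Real.pi ^ 2 ≤ 10 := by nlinarith
  have hL0 : 0 < L := by linarith
  have hy0 : 0 < y := by linarith
  set t := Real.pi ^ 2 / (2 * y) with ht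
  have ht0 : 0 ≤ t := by positivity
  have htL : t ≤ 10 / L := by
    rw [ht, div_le_div_iff₀ (by positivity) hL0]
    nlinarith
  have ht1 : t ≤ 1 := htL.trans (by rw [div_le_one hL0]; exact hL)
  have h1 : Real.exp t - 1 ≤ 2 * t := by
    have := Real.abs_exp_sub_one_le (x := t) (by rwa [abs_of_nonneg ht0])
    rw [abs_of_nonneg ht0] at this
    exact (le_abs_self _).trans this
  have h2 : c * Real.pi ^ 2 * L ^ 3 / y ^ 4 ≤ 160 * c / L := by
    rw [div_le_div_iff₀ (by positivity) hL0]
    have a1 : L ^ 4 ≤ (2 * y) ^ 4 := by gcongr; linarith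
    have a2 : c * Real.pi ^ 2 * L ^ 4 ≤ c * 10 * (2 * y) ^ 4 := by gcongr
    nlinarith
  have h3 := Real.add_one_le_exp (-(c * Real.pi ^ 2 * L ^ 3 / y ^ 4))
  have e : (20 + 160 * c) / L = 2 * (10 / L) + 160 * c / L := by ring
  have h4 : 0 ≤ 160 * c / L := by positivity
  rw [abs_le, e]
  constructor <;> linarith

/-- The exact exponent differs from its quadratic part by a cubic remainder; both are at least the
quadratic with coefficient 2c/3. -/
lemma abs_gaussian_sub_le {c y L : ℝ} (hc : 0 < c) (hL : 0 < L) (hy : L / 2 ≤ y)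
    (hy2 : y ≤ 3 * L / 2) :
    |Real.exp (-(c * ((y - L) ^ 2 * (2 * y + L) / (2 * y ^ 2)))) -
      Real.exp (-(3 * c / 2 * (y - L) ^ 2 / L))| ≤
      11 * c * |y - L| ^ 3 / L ^ 2 * Real.exp (-(2 * c / 3 * (y - L) ^ 2 / L)) ∧
    Real.exp (-(c * ((y - L) ^ 2 * (2 * y + L) / (2 * y ^ 2)))) ≤
      Real.exp (-(2 * c / 3 * (y - L) ^ 2 / L)) := by
  have hy0 : 0 < y := by linarith
  have hu : 2 * c / 3 * (y - L) ^ 2 / L ≤ c * ((y - L) ^ 2 * (2 * y + L) / (2 * y ^ 2)) := by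
    have h : 2 / (3 * L) ≤ (2 * y + L) / (2 * y ^ 2) := by
      rw [div_le_div_iff₀ (by positivity) (by positivity)]
      nlinarith
    calc 2 * c / 3 * (y - L) ^ 2 / L = c * (y - L) ^ 2 * (2 / (3 * L)) := by field_simp
      _ ≤ c * (y - L) ^ 2 * ((2 * y + L) / (2 * y ^ 2)) := by gcongr
      _ = _ := by ring
  have hv : 2 * c / 3 * (y - L) ^ 2 / L ≤ 3 * c / 2 * (y - L) ^ 2 / L := by
    gcongr ?_ * _ / _
    linarith
  refine ⟨(abs_exp_neg_sub_exp_neg_le hu hv).trans ?_, Real.exp_le_exp.2 (by linarith)⟩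
  gcongr
  have e : c * ((y - L) ^ 2 * (2 * y + L) / (2 * y ^ 2)) - 3 * c / 2 * (y - L) ^ 2 / L =
      c * (y - L) ^ 2 * ((L - y) * ((L + 3 * y) / (2 * y ^ 2 * L))) := by
    field_simp
    ring
  rw [e, abs_mul, abs_mul (L - y), abs_of_nonneg (by positivity : 0 ≤ c * (y - L) ^ 2), abs_sub_comm L,
    abs_of_nonneg (by positivity : 0 ≤ (L + 3 * y) / (2 * y ^ 2 * L))]
  have h : (L + 3 * y) / (2 * y ^ 2 * L) ≤ 11 / L ^ 2 := by
    rw [div_le_div_iff₀ (by positivity) (by positivity)]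
    have : (L + 3 * y) * L ≤ 11 * (2 * y ^ 2) := by nlinarith
    nlinarith [mul_le_mul_of_nonneg_right this hL.le]
  calc c * (y - L) ^ 2 * (|y - L| * ((L + 3 * y) / (2 * y ^ 2 * L)))
      ≤ c * (y - L) ^ 2 * (|y - L| * (11 / L ^ 2)) := by gcongr
    _ = _ := by rw [← sq_abs]; ring

/-- Gaussian approximation of the dominant term close to the saddle point. -/
lemma exists_near_bound {c : ℝ} (hc : 0 < c) : ∃ C : ℝ, 0 ≤ C ∧ ∀ L y R : ℝ, 10 ≤ L →
    L / 2 ≤ y → y ≤ 3 * L / 2 → Real.exp (-(c * Real.pi ^ 2 * L ^ 3 / y ^ 4)) ≤ R →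
    R ≤ Real.exp (Real.pi ^ 2 / (2 * y)) →
    |L ^ 3 / (Real.pi ^ 2 * y) * Real.sin (Real.pi / y) ^ 2 * R *
        Real.exp (-(c * ((y - L) ^ 2 * (2 * y + L) / (2 * y ^ 2)))) -
      Real.exp (-(3 * c / 2 * (y - L) ^ 2 / L))| ≤
      C * ((Real.sqrt L)⁻¹ * Real.exp (-(c / 3 * (y - L) ^ 2 / L))) := by
  set K := 16 * (21 + 160 * c) + (20 + 160 * c) + 14 * (21 + 160 * c) + 11 * c with hK
  refine ⟨K * (3 + 6 / (c / 3) ^ 2), by positivity, fun L y R hL hy hy2 hR1 hR2 => ?_⟩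
  have hL0 : 0 < L := by linarith
  have hP := abs_prefactor_sub_one_le hL hy
  have hR := abs_correction_sub_one_le hc hL hy hR1 hR2
  obtain ⟨hg, hh⟩ := abs_gaussian_sub_le hc hL0 hy hy2
  set P := L ^ 3 / (Real.pi ^ 2 * y) * Real.sin (Real.pi / y) ^ 2
  set h := Real.exp (-(c * ((y - L) ^ 2 * (2 * y + L) / (2 * y ^ 2))))
  set g := Real.exp (-(3 * c / 2 * (y - L) ^ 2 / L))
  set s := Real.sqrt L with hs
  have hs0 : 0 < s := Real.sqrt_pos.2 hL0
  have hsL : s ^ 2 = L := Real.sq_sqrt hL0.le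
  have hs1 : 1 ≤ s := Real.one_le_sqrt.2 (by linarith)
  -- Natural scale: in units of √L all errors become a polynomial in `w` times `s⁻¹`.
  set w := |y - L| / s with hw
  have hw0 : 0 ≤ w := by positivity
  have hyw : |y - L| = w * s := by rw [hw]; field_simp
  have hw2 : (y - L) ^ 2 / L = w ^ 2 := by rw [← sq_abs, hyw, mul_pow, hsL]; field_simp
  set E := Real.exp (-(2 * c / 3 * (y - L) ^ 2 / L)) with hE
  have hE0 : 0 < E := Real.exp_pos _
  -- One half of the Gaussian absorbs the polynomial in `w`, the other keeps the bound summable over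
  -- `y`.
  have hEE : E = Real.exp (-(c / 3 * w ^ 2)) * Real.exp (-(c / 3 * w ^ 2)) := by
    rw [hE, ← Real.exp_add, ← hw2]; ring_nf
  have hP' : |P - 1| ≤ (14 * w + 16) * s⁻¹ := by
    refine hP.trans ?_
    rw [hyw, ← hsL]
    have e1 : 14 * (w * s) / s ^ 2 = 14 * w * s⁻¹ := by field_simp
    have e2 : 16 / s ^ 2 ≤ 16 * s⁻¹ := by
      rw [← div_eq_mul_inv]; gcongr; nlinarith
    rw [e1]; linarith
  have hR' : |R - 1| ≤ (20 + 160 * c) * s⁻¹ := by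
    refine hR.trans ?_
    rw [← hsL, ← div_eq_mul_inv]
    gcongr
    nlinarith
  have hsinv : s⁻¹ ≤ 1 := inv_le_one_of_one_le₀ hs1
  have hRabs : |R| ≤ 21 + 160 * c := by
    have h1 : |R| ≤ |R - 1| + 1 := by
      have := abs_add_le (R - 1) 1
      simpa using this
    have h2 : (20 + 160 * c) * s⁻¹ ≤ 20 + 160 * c := mul_le_of_le_one_right (by positivity) hsinv
    linarith
  have hg' : |h - g| ≤ 11 * c * w ^ 3 * s⁻¹ * E := by
    refine hg.trans_eq ?_
    rw [hyw, ← hsL]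
    field_simp
  have hPR : |P * R - 1| ≤ ((14 * w + 16) * (21 + 160 * c) + (20 + 160 * c)) * s⁻¹ := by
    rw [show P * R - 1 = (P - 1) * R + (R - 1) by ring]
    refine (abs_add_le _ _).trans ?_
    rw [abs_mul]
    have := mul_le_mul hP' hRabs (abs_nonneg _) (by positivity)
    linarith
  have hh0 : 0 < h := Real.exp_pos _
  have hfin : |P * R * h - g| ≤
      s⁻¹ * E * (((14 * w + 16) * (21 + 160 * c) + (20 + 160 * c)) + 11 * c * w ^ 3) := by
    rw [show P * R * h - g = (P * R - 1) * h + (h - g) by ring]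
    refine (abs_add_le _ _).trans ?_
    rw [abs_mul, abs_of_pos hh0]
    have := mul_le_mul hPR hh hh0.le (by positivity)
    linarith
  have hpoly : ((14 * w + 16) * (21 + 160 * c) + (20 + 160 * c)) + 11 * c * w ^ 3 ≤
      K * (1 + w + w ^ 3) := by
    have hw3 : 0 ≤ w ^ 3 := by positivity
    have a1 : 0 ≤ c * w := by positivity
    have a2 : 0 ≤ c * w ^ 3 := by positivity
    rw [hK]
    nlinarith
  calc |P * R * h - g|
      ≤ s⁻¹ * E * (K * (1 + w + w ^ 3)) := hfin.trans (by gcongr)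
    _ = K * ((1 + w + w ^ 3) * Real.exp (-(c / 3 * w ^ 2))) *
        (s⁻¹ * Real.exp (-(c / 3 * w ^ 2))) := by rw [hEE]; ring
    _ ≤ K * (3 + 6 / (c / 3) ^ 2) * (s⁻¹ * Real.exp (-(c / 3 * w ^ 2))) := by
        gcongr
        exact poly_mul_exp_neg_sq_le (by positivity)
    _ = _ := by rw [mul_div_assoc, hw2]

/-! ### Termwise Gaussian approximation -/

/-- Bounds for the dominant eigenvalue. -/
lemma cos_pow_le {n N : ℕ} (hn : 2 ≤ n) (hnN : n ≤ 2 * N) :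
    Real.cos (Real.pi / n) ^ (2 * N - n) ≤
      Real.exp (-(Real.pi ^ 2 * N / n ^ 2) + Real.pi ^ 2 / (2 * n)) := by
  have hn0 : (0 : ℝ) < n := by exact_mod_cast (by omega : 0 < n)
  have hn2 : (2 : ℝ) ≤ n := by exact_mod_cast hn
  have hle : Real.pi / n ≤ Real.pi / 2 := by gcongr
  have h0 : 0 ≤ Real.pi / n := by positivity
  have h1 := Real.cos_le_exp_neg_sq_div_two h0 hle
  have hc : 0 ≤ Real.cos (Real.pi / n) := Real.cos_nonneg_of_mem_Icc ⟨by linarith [Real.pi_pos], hle⟩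
  refine (pow_le_pow_left₀ hc h1 _).trans_eq ?_
  rw [← Real.exp_nat_mul, Nat.cast_sub hnN]
  congr 1
  push_cast
  field_simp
  ring

lemma le_cos_pow {n N : ℕ} (hn : 4 ≤ n) (hnN : n ≤ 2 * N) :
    Real.exp (-(Real.pi ^ 2 * N / n ^ 2) - 2 * Real.pi ^ 4 * N / n ^ 4) ≤
      Real.cos (Real.pi / n) ^ (2 * N - n) := by
  have hn0 : (0 : ℝ) < n := by exact_mod_cast (by omega : 0 < n)
  have hn4 : (4 : ℝ) ≤ n := by exact_mod_cast hn
  have h0 : 0 ≤ Real.pi / n := by positivity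
  have hx : |Real.pi / n| ≤ 1 := by
    rw [abs_of_nonneg h0, div_le_one hn0]
    linarith [Real.pi_le_four]
  have h1 := Real.exp_neg_le_cos hx
  refine le_trans ?_ (pow_le_pow_left₀ (Real.exp_pos _).le h1 _)
  rw [← Real.exp_nat_mul, Real.exp_le_exp, Nat.cast_sub hnN]
  push_cast
  -- Dropping `-n` from the exponent `2 * N - n` only weakens the lower bound.
  have h2 : 0 ≤ (n : ℝ) * ((Real.pi / n) ^ 2 / 2 + (Real.pi / n) ^ 4) := by positivity
  have h3 : (Real.pi ^ 2 * N / n ^ 2) + 2 * Real.pi ^ 4 * N / n ^ 4 =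
      2 * N * ((Real.pi / n) ^ 2 / 2 + (Real.pi / n) ^ 4) := by
    field_simp
  linarith

/-- The contribution of the extreme eigenvalues, away from the saddle point. -/
lemma abs_main_term_far_le {c L : ℝ} (hc : 0 < c) (hL : 0 < L) {n N : ℕ}
    (hN : Real.pi ^ 2 * N = c * L ^ 3 / 2) (hn : 2 ≤ n) (hnN : n ≤ 2 * N)
    (hfar : L / 2 < |(n : ℝ) - L|) :
    |L ^ 3 / (Real.pi ^ 2 * n) * Real.sin (Real.pi / n) ^ 2 *
        (Real.cos (Real.pi / n) ^ (2 * N - n) * Real.exp (-c * (n - 3 * L / 2)))| ≤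
      6 / (c / 20) ^ 3 * Real.exp (Real.pi ^ 2) * Real.exp (-(c / 20) * n) := by
  have hπ := Real.pi_gt_three
  have hn2 : (2 : ℝ) ≤ n := by exact_mod_cast hn
  have hn0 : (0 : ℝ) < n := by linarith
  have hcos : 0 ≤ Real.cos (Real.pi / n) := Real.cos_nonneg_of_mem_Icc
    ⟨by have : 0 ≤ Real.pi / n := by positivity
        linarith, by gcongr⟩
  rw [abs_of_nonneg (by positivity)]
  have h1 : L ^ 3 / (Real.pi ^ 2 * n) * Real.sin (Real.pi / n) ^ 2 ≤ L ^ 3 := by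
    have a1 : L ^ 3 / (Real.pi ^ 2 * n) ≤ L ^ 3 := div_le_self (by positivity) (by nlinarith)
    calc _ ≤ L ^ 3 * 1 := by gcongr; exact Real.sin_sq_le_one _
      _ = _ := mul_one _
  have h2 : Real.cos (Real.pi / n) ^ (2 * N - n) * Real.exp (-c * (n - 3 * L / 2)) ≤
      Real.exp (-(c / 20 * L)) * (Real.exp (Real.pi ^ 2) * Real.exp (-(c / 20) * n)) := by
    calc _ ≤ Real.exp (-(Real.pi ^ 2 * N / n ^ 2) + Real.pi ^ 2 / (2 * n)) *
          Real.exp (-c * (n - 3 * L / 2)) := by gcongr; exact cos_pow_le hn hnN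
      _ ≤ _ := by
          rw [← Real.exp_add, ← Real.exp_add, ← Real.exp_add, Real.exp_le_exp, hN]
          have a1 := mul_le_mul_of_nonneg_left (exponent_far hL hn0 hfar) hc.le
          have a2 : Real.pi ^ 2 / (2 * n) ≤ Real.pi ^ 2 :=
            div_le_self (by positivity) (by linarith)
          have a3 : c * L ^ 3 / 2 / n ^ 2 = c * (L ^ 3 / (2 * n ^ 2)) := by field_simp
          rw [a3]
          linarith
  calc _ ≤ L ^ 3 * (Real.exp (-(c / 20 * L)) *
        (Real.exp (Real.pi ^ 2) * Real.exp (-(c / 20) * n))) := by gcongr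
    _ = (L ^ 3 * Real.exp (-(c / 20 * L))) *
        (Real.exp (Real.pi ^ 2) * Real.exp (-(c / 20) * n)) := by ring
    _ ≤ 6 / (c / 20) ^ 3 * (Real.exp (Real.pi ^ 2) * Real.exp (-(c / 20) * n)) := by
        gcongr
        exact cube_mul_exp_neg_le (by positivity) hL.le
    _ = _ := by ring

/-- The contribution of the other eigenvalues is exponentially small. -/
lemma error_term_le {c L : ℝ} (hc : 0 < c) (hL : 0 < L) {n N : ℕ}
    (hN : Real.pi ^ 2 * N = c * L ^ 3 / 2) (hn : 2 ≤ n) (hnN : n ≤ 2 * N) :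
    L ^ 3 * (Real.exp (-c * (n - 3 * L / 2)) *
        Real.exp (-(2 * Real.pi ^ 2 / n ^ 2) * (2 * N - n : ℕ))) ≤
      6 / (c / 20) ^ 3 * Real.exp (Real.pi ^ 2) * Real.exp (-(c / 20) * n) := by
  have hπ := Real.pi_gt_three
  have hn2 : (2 : ℝ) ≤ n := by exact_mod_cast hn
  have hn0 : (0 : ℝ) < n := by linarith
  have h2 : Real.exp (-c * (n - 3 * L / 2)) *
        Real.exp (-(2 * Real.pi ^ 2 / n ^ 2) * (2 * N - n : ℕ)) ≤
      Real.exp (-(c / 20 * L)) * (Real.exp (Real.pi ^ 2) * Real.exp (-(c / 20) * n)) := by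
    rw [← Real.exp_add, ← Real.exp_add, ← Real.exp_add, Real.exp_le_exp, Nat.cast_sub hnN]
    have a1 := mul_le_mul_of_nonneg_left (exponent_double hL hn0) hc.le
    have a2 : 2 * Real.pi ^ 2 / n ≤ Real.pi ^ 2 := by
      rw [div_le_iff₀ hn0]
      nlinarith [sq_nonneg Real.pi]
    have a3 : -(2 * Real.pi ^ 2 / (n : ℝ) ^ 2) * ((2 * N : ℕ) - n) =
        -(4 * (Real.pi ^ 2 * N) / n ^ 2) + 2 * Real.pi ^ 2 / n := by
      push_cast
      field_simp
      ring
    have a4 : 4 * (c * L ^ 3 / 2) / (n : ℝ) ^ 2 = c * (2 * L ^ 3 / n ^ 2) := by field_simp; norm_num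
    have a5 : 0 ≤ c * n := by positivity
    have a6 : 0 ≤ c * L := by positivity
    rw [a3, hN, a4]
    linarith
  calc _ ≤ L ^ 3 * (Real.exp (-(c / 20 * L)) *
        (Real.exp (Real.pi ^ 2) * Real.exp (-(c / 20) * n))) := by gcongr
    _ = (L ^ 3 * Real.exp (-(c / 20 * L))) *
        (Real.exp (Real.pi ^ 2) * Real.exp (-(c / 20) * n)) := by ring
    _ ≤ 6 / (c / 20) ^ 3 * (Real.exp (Real.pi ^ 2) * Real.exp (-(c / 20) * n)) := by
        gcongr
        exact cube_mul_exp_neg_le (by positivity) hL.le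
    _ = _ := by ring

/-- Gaussian approximation of the individual terms of the partition function. -/
lemma exists_term_bound {c : ℝ} (hc : 0 < c) : ∃ C : ℝ, 0 ≤ C ∧ ∀ (L : ℝ) (n N : ℕ), 10 ≤ L →
    Real.pi ^ 2 * N = c * L ^ 3 / 2 → 2 ≤ N → 2 ≤ n → n ≤ N + 1 →
    |L ^ 3 / (4 * Real.pi ^ 2) * (Real.exp (-c * (n - 3 * L / 2)) *
        (2 / n * spectralSum n (2 * N - n))) - Real.exp (-(3 * c / 2) * (n - L) ^ 2 / L)| ≤
      C * ((Real.sqrt L)⁻¹ * Real.exp (-(c / 3) * (n - L) ^ 2 / L) +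
        Real.exp (-(c / 20) * n)) := by
  obtain ⟨C₁, hC₁, hnear⟩ := exists_near_bound hc
  set C₂ := 6 / (c / 20) ^ 3 * Real.exp (Real.pi ^ 2) with hC₂
  have hC₂0 : 0 ≤ C₂ := by positivity
  -- `C₁` covers the saddle region, one `C₂` the far main term, the other `C₂` the remaining
  -- eigenvalues, and 1 the far Gaussian.
  refine ⟨C₁ + 2 * C₂ + 1, by positivity, fun L n N hL hN hN2 hn hnN => ?_⟩
  have hπ := Real.pi_gt_three
  have hL0 : 0 < L := by linarith
  have hn2 : (2 : ℝ) ≤ n := by exact_mod_cast hn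
  have hn0 : (0 : ℝ) < n := by linarith
  set Q := Real.cos (Real.pi / n) ^ (2 * N - n) with hQ
  set T := Real.exp (-c * (n - 3 * L / 2)) with hT
  have hS := abs_spectralSum_sub_le (n := n) (e := 2 * N - n) hn (by omega)
    ⟨N, by omega⟩
  rw [← hQ] at hS
  set S := spectralSum n (2 * N - n)
  set G := Real.exp (-(3 * c / 2) * (n - L) ^ 2 / L) with hG
  set M := L ^ 3 / (Real.pi ^ 2 * n) * Real.sin (Real.pi / n) ^ 2 * (Q * T) with hM
  have hsplit : L ^ 3 / (4 * Real.pi ^ 2) * (T * (2 / n * S)) - G =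
      (M - G) + L ^ 3 / (4 * Real.pi ^ 2) * (T * (2 / n *
        (S - 2 * Real.sin (Real.pi / n) ^ 2 * Q))) := by
    rw [hM]
    field_simp
    ring
  have hErr : |L ^ 3 / (4 * Real.pi ^ 2) * (T * (2 / n *
        (S - 2 * Real.sin (Real.pi / n) ^ 2 * Q)))| ≤ C₂ * Real.exp (-(c / 20) * n) := by
    refine le_trans ?_ (error_term_le hc hL0 hN hn (by omega))
    rw [abs_mul, abs_mul, abs_mul, abs_of_nonneg (by positivity : 0 ≤ L ^ 3 / (4 * Real.pi ^ 2)),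
      abs_of_nonneg (Real.exp_pos _).le, abs_of_nonneg (by positivity : (0 : ℝ) ≤ 2 / n)]
    calc _ ≤ L ^ 3 / (4 * Real.pi ^ 2) * (T * (2 / n *
          (n * Real.exp (-(2 * Real.pi ^ 2 / n ^ 2) * (2 * N - n : ℕ))))) := by gcongr
      _ = (L ^ 3 / (2 * Real.pi ^ 2)) *
          (T * Real.exp (-(2 * Real.pi ^ 2 / n ^ 2) * (2 * N - n : ℕ))) := by
          field_simp
          ring
      _ ≤ _ := by
          gcongr
          exact div_le_self (by positivity) (by nlinarith)
  have hE1 : 0 ≤ (Real.sqrt L)⁻¹ * Real.exp (-(c / 3) * (n - L) ^ 2 / L) := by positivity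
  have hE2 := Real.exp_pos (-(c / 20) * n)
  have hMain : |M - G| ≤ C₁ * ((Real.sqrt L)⁻¹ * Real.exp (-(c / 3) * (n - L) ^ 2 / L)) +
      (C₂ + 1) * Real.exp (-(c / 20) * n) := by
    rcases lt_or_ge (L / 2) |(n : ℝ) - L| with hfar | hclose
    · have h1 := abs_main_term_far_le hc hL0 hN hn (by omega) hfar
      have h2 := gaussian_far hc hL0 hn0.le hfar
      have h3 := abs_sub M G
      rw [abs_of_pos (Real.exp_pos _ : 0 < G)] at h3
      have h4 := mul_nonneg hC₁ hE1
      have h5 : |M| ≤ C₂ * Real.exp (-(c / 20) * n) := h1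
      linarith
    · rw [abs_le] at hclose
      have hlo : L / 2 ≤ n := by linarith [hclose.1]
      have hhi : (n : ℝ) ≤ 3 * L / 2 := by linarith [hclose.2]
      have hn4 : 4 ≤ n := by
        have : (4 : ℝ) ≤ n := by linarith
        exact_mod_cast this
      have hnum : Real.pi ^ 2 * N / (n : ℝ) ^ 2 = c * L ^ 3 / (2 * n ^ 2) := by
        rw [hN]; field_simp
      -- The argument `R` is `Q` with its leading exponential exp(-π²N/n²) divided out.
      have h1 := hnear L n (Q * Real.exp (c * L ^ 3 / (2 * n ^ 2))) hL hlo hhi ?_ ?_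
      · have e1 : L ^ 3 / (Real.pi ^ 2 * n) * Real.sin (Real.pi / n) ^ 2 *
            (Q * Real.exp (c * L ^ 3 / (2 * n ^ 2))) *
            Real.exp (-(c * ((n - L) ^ 2 * (2 * n + L) / (2 * n ^ 2)))) = M := by
          rw [← exponent_identity hn0.ne', hM, mul_assoc, mul_assoc Q, ← Real.exp_add, hT]
          congr 3
          ring_nf
        have e2 : Real.exp (-(3 * c / 2 * (n - L) ^ 2 / L)) = G := by rw [hG]; ring_nf
        have e3 : Real.exp (-(c / 3 * (n - L) ^ 2 / L)) = Real.exp (-(c / 3) * (n - L) ^ 2 / L) := by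
          ring_nf
        rw [e1, e2, e3] at h1
        have h4 : 0 ≤ (C₂ + 1) * Real.exp (-(c / 20) * n) := by positivity
        linarith
      · have h2 := le_cos_pow hn4 (by omega : n ≤ 2 * N)
        calc _ = Real.exp (-(Real.pi ^ 2 * N / n ^ 2) - 2 * Real.pi ^ 4 * N / n ^ 4) *
            Real.exp (c * L ^ 3 / (2 * n ^ 2)) := by
              rw [← Real.exp_add, hnum, show 2 * Real.pi ^ 4 * N / (n : ℝ) ^ 4 =
                c * Real.pi ^ 2 * L ^ 3 / n ^ 4 by
                  rw [show 2 * Real.pi ^ 4 * (N : ℝ) = 2 * Real.pi ^ 2 * (Real.pi ^ 2 * N) by ring,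
                    hN]
                  ring]
              ring_nf
          _ ≤ _ := by gcongr
      · have h2 := cos_pow_le hn (by omega : n ≤ 2 * N)
        calc _ ≤ Real.exp (-(Real.pi ^ 2 * N / n ^ 2) + Real.pi ^ 2 / (2 * n)) *
            Real.exp (c * L ^ 3 / (2 * n ^ 2)) := by gcongr
          _ = _ := by
            rw [← Real.exp_add, hnum]
            ring_nf
  rw [hsplit]
  refine (abs_add_le _ _).trans ((add_le_add hMain hErr).trans ?_)
  have := mul_nonneg hC₂0 hE1
  nlinarith [mul_nonneg hC₁ hE2.le]

/-! ### Summation over heights -/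

/-- The terms of the normalized partition function. -/
noncomputable def saddleTerm (c : ℝ) (N k : ℕ) : ℝ :=
  if k + 1 ≤ N then Real.exp (-c * (k + 2 : ℕ)) *
    (2 / (k + 2 : ℕ) * spectralSum (k + 2) (2 * N - (k + 2))) else 0

lemma summable_saddleTerm (c : ℝ) (N : ℕ) : Summable (saddleTerm c N) := by
  refine summable_of_ne_finset_zero (s := Finset.range N) fun k hk => ?_
  rw [Finset.mem_range] at hk
  rw [saddleTerm, if_neg (by omega)]

/-- The normalized partition function is approximated by the Gaussian integral. -/
lemma exists_saddle_sum_bound {c : ℝ} (hc : 0 < c) : ∃ C L₀ : ℝ, 0 ≤ C ∧ 10 ≤ L₀ ∧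
    ∀ (L : ℝ) (N : ℕ), L₀ ≤ L → Real.pi ^ 2 * N = c * L ^ 3 / 2 →
    |L ^ 3 / (4 * Real.pi ^ 2) * (Real.exp (3 * c * L / 2) * ∑' k, saddleTerm c N k) -
      Real.sqrt (Real.pi * L / (3 * c / 2))| ≤ C := by
  obtain ⟨C₀, hC₀, hterm⟩ := exists_term_bound hc
  obtain ⟨C₁, hC₁, hg⟩ := exists_gaussian_nat_sum_bound (κ := 3 * c / 2) (by positivity)
  obtain ⟨C₂, hC₂, hg'⟩ := exists_gaussian_nat_sum_bound (κ := c / 3) (by positivity)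
  set r := Real.exp (-(c / 20)) with hr
  have hr0 : 0 < r := Real.exp_pos _
  have hr1 : r < 1 := by rw [hr, Real.exp_lt_one_iff]; linarith
  have hr1' : 0 ≤ (1 - r)⁻¹ := inv_nonneg.2 (by linarith)
  -- The threshold 30/c yields N ≥ 3L/2, so that terms cut off at height `N` lie in the far region,
  -- where the Gaussian is exponentially small.
  refine ⟨(C₀ + 1) * ((Real.sqrt (Real.pi / (c / 3)) + C₂) + (1 - r)⁻¹) + C₁, max 10 (30 / c),
    by positivity, le_max_left _ _, fun L N hL hN => ?_⟩
  have hπ := Real.pi_gt_three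
  have hπ4 := Real.pi_lt_d2
  have hL10 : 10 ≤ L := (le_max_left _ _).trans hL
  have hLc : 30 / c ≤ L := (le_max_right _ _).trans hL
  have hL0 : 0 < L := by linarith
  have hNL : 3 * L / 2 ≤ N := by
    rw [div_le_iff₀ hc] at hLc
    have h1 : 300 ≤ c * L ^ 2 := by nlinarith
    have h2 : 300 * L ≤ c * L ^ 3 := by nlinarith
    have h3 : 150 * L ≤ Real.pi ^ 2 * N := by linarith
    have h4 : Real.pi ^ 2 * N ≤ 10 * N := by
      have : (0 : ℝ) ≤ N := Nat.cast_nonneg N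
      gcongr
      nlinarith
    linarith
  have hN2 : 2 ≤ N := by
    have : (2 : ℝ) ≤ N := by linarith
    exact_mod_cast this
  set B : ℕ → ℝ := fun k => L ^ 3 / (4 * Real.pi ^ 2) * (Real.exp (3 * c * L / 2) * saddleTerm c N k)
    with hB
  have hBs : Summable B := ((summable_saddleTerm c N).mul_left _).mul_left _
  obtain ⟨hgs, hgb⟩ := hg L (by linarith)
  obtain ⟨hgs', hgb'⟩ := hg' L (by linarith)
  have hgeo := summable_geometric_of_lt_one hr0.le hr1
  have hbound : ∀ k, |B k - Real.exp (-(3 * c / 2) * ((k + 2 : ℕ) - L) ^ 2 / L)| ≤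
      (C₀ + 1) * ((Real.sqrt L)⁻¹ * Real.exp (-(c / 3) * ((k + 2 : ℕ) - L) ^ 2 / L) + r ^ k) := by
    intro k
    have hE1 : 0 ≤ (Real.sqrt L)⁻¹ * Real.exp (-(c / 3) * ((k + 2 : ℕ) - L) ^ 2 / L) := by
      positivity
    have hrk : Real.exp (-(c / 20) * (k + 2 : ℕ)) ≤ r ^ k := by
      rw [hr, ← Real.exp_nat_mul, Real.exp_le_exp]
      push_cast
      nlinarith
    have hrk0 : 0 ≤ r ^ k := by positivity
    by_cases hk : k + 1 ≤ N
    · have h := hterm L (k + 2) N hL10 hN hN2 (by omega) (by omega)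
      have e : B k = L ^ 3 / (4 * Real.pi ^ 2) * (Real.exp (-c * ((k + 2 : ℕ) - 3 * L / 2)) *
          (2 / (k + 2 : ℕ) * spectralSum (k + 2) (2 * N - (k + 2)))) := by
        simp only [hB, saddleTerm, if_pos hk]
        rw [← mul_assoc (Real.exp _), ← Real.exp_add]
        ring_nf
      rw [e]
      refine h.trans ?_
      gcongr
      linarith
    · have e : B k = 0 := by simp only [hB, saddleTerm, if_neg hk, mul_zero]
      rw [e, zero_sub, abs_neg, abs_of_pos (Real.exp_pos _)]
      have hkN : (N : ℝ) ≤ (k + 2 : ℕ) := by exact_mod_cast (by omega : N ≤ k + 2)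
      have hkN' : (N : ℝ) < (k + 2 : ℕ) := by exact_mod_cast (by omega : N < k + 2)
      have h := gaussian_far hc hL0 (Nat.cast_nonneg (k + 2))
        (lt_of_lt_of_le (by linarith) (le_abs_self _))
      nlinarith [mul_nonneg hC₀ hE1, mul_nonneg hC₀ hrk0]
  have hsumbd := ((hgs'.mul_left (Real.sqrt L)⁻¹).add hgeo).mul_left (C₀ + 1)
  have h1 : |∑' k, (B k - Real.exp (-(3 * c / 2) * ((k + 2 : ℕ) - L) ^ 2 / L))| ≤
      ∑' k : ℕ, (C₀ + 1) *
        ((Real.sqrt L)⁻¹ * Real.exp (-(c / 3) * ((k + 2 : ℕ) - L) ^ 2 / L) + r ^ k) := by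
    rw [← Real.norm_eq_abs]
    exact tsum_of_norm_bounded hsumbd.hasSum hbound
  have hBt : ∑' k, B k = L ^ 3 / (4 * Real.pi ^ 2) *
      (Real.exp (3 * c * L / 2) * ∑' k, saddleTerm c N k) := by
    simp only [hB, tsum_mul_left]
  have hRt : ∑' k : ℕ, (C₀ + 1) *
        ((Real.sqrt L)⁻¹ * Real.exp (-(c / 3) * ((k + 2 : ℕ) - L) ^ 2 / L) + r ^ k) =
      (C₀ + 1) * ((Real.sqrt L)⁻¹ *
        ∑' k : ℕ, Real.exp (-(c / 3) * ((k + 2 : ℕ) - L) ^ 2 / L) + (1 - r)⁻¹) := by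
    rw [tsum_mul_left, (hgs'.mul_left _).tsum_add hgeo, tsum_mul_left,
      tsum_geometric_of_lt_one hr0.le hr1]
  rw [hBs.tsum_sub hgs, hBt, hRt] at h1
  have hs1 : 1 ≤ Real.sqrt L := Real.one_le_sqrt.2 (by linarith)
  -- The Gaussian sum has order √L, so the termwise errors of relative size 1/√L add up to O(1).
  have h2 : (Real.sqrt L)⁻¹ * ∑' k : ℕ, Real.exp (-(c / 3) * ((k + 2 : ℕ) - L) ^ 2 / L) ≤
      Real.sqrt (Real.pi / (c / 3)) + C₂ := by
    rw [inv_mul_le_iff₀ (by linarith)]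
    have a1 := (abs_le.1 hgb').2
    have a2 : Real.sqrt (Real.pi * L / (c / 3)) = Real.sqrt L * Real.sqrt (Real.pi / (c / 3)) := by
      rw [← Real.sqrt_mul hL0.le]; ring_nf
    nlinarith
  have h3 := mul_le_mul_of_nonneg_left (add_le_add_left h2 (1 - r)⁻¹)
    (by linarith : 0 ≤ C₀ + 1)
  refine (abs_sub_le _ (∑' k : ℕ, Real.exp (-(3 * c / 2) * ((k + 2 : ℕ) - L) ^ 2 / L)) _).trans ?_
  linarith

/-! ### Identification of the constants and conclusion -/

/-- With n = k + 2, the power 2^{2N-n} from the eigenvalues `2 * cos` splits as 4^N 2^{-n}; the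
factor 2^{-n} shifts μ to μ + ln 2, which is the origin of the critical coupling. -/
lemma partitionFunction_eq (μ : ℝ) {N : ℕ} (hN : 1 ≤ N) :
    partitionFunction μ N = 4 ^ N * Real.exp μ * ∑' k, saddleTerm (μ + Real.log 2) N k := by
  rw [partitionFunction, ← tsum_mul_left]
  refine tsum_congr fun k => ?_
  by_cases hk : k + 1 ≤ N
  · obtain ⟨N, rfl⟩ := Nat.exists_eq_add_of_le' hN
    rw [saddleTerm, if_pos hk, numOneSided_eq_sum (by omega)]
    set e := 2 * N - k with he
    rw [show 2 * (N + 1) - (k + 2) = e by omega, spectralSum]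
    have h1 : ∑ j ∈ Finset.range (k + 2), (-1) ^ (j + 1) *
          Real.sin (j * Real.pi / (k + 2 : ℕ)) ^ 2 * (2 * Real.cos (j * Real.pi / (k + 2 : ℕ))) ^ e =
        2 ^ e * ∑ j ∈ Finset.range (k + 2), (-1) ^ (j + 1) *
          Real.sin (j * Real.pi / (k + 2 : ℕ)) ^ 2 * Real.cos (j * Real.pi / (k + 2 : ℕ)) ^ e := by
      rw [Finset.mul_sum]
      refine Finset.sum_congr rfl fun j _ => ?_
      rw [mul_pow]; ring
    have h2 : Real.exp (-μ * ((k + 1 : ℕ) : ℝ)) * 2 ^ e =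
        4 ^ (N + 1) * Real.exp μ * Real.exp (-(μ + Real.log 2) * (k + 2 : ℕ)) := by
      have a1 : Real.exp (-(μ + Real.log 2) * (k + 2 : ℕ)) =
          Real.exp (-μ * (k + 2 : ℕ)) * ((2 : ℝ) ^ (k + 2))⁻¹ := by
        rw [← Real.exp_log (show (0 : ℝ) < 2 by norm_num), ← Real.exp_nat_mul, ← Real.exp_neg,
          ← Real.exp_add, Real.log_exp]
        ring_nf
      have a2 : Real.exp μ * Real.exp (-μ * (k + 2 : ℕ)) = Real.exp (-μ * (k + 1 : ℕ)) := by
        rw [← Real.exp_add]; push_cast; ring_nf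
      have a3 : (4 : ℝ) ^ (N + 1) = 2 ^ e * 2 ^ (k + 2) := by
        rw [show (4 : ℝ) = 2 ^ 2 by norm_num, ← pow_mul, ← pow_add]
        congr 1
        omega
      rw [a1, ← a2, a3]
      field_simp
    rw [h1]
    linear_combination (2 / (k + 2 : ℕ) * ∑ j ∈ Finset.range (k + 2), (-1) ^ (j + 1) *
          Real.sin (j * Real.pi / (k + 2 : ℕ)) ^ 2 *
          Real.cos (j * Real.pi / (k + 2 : ℕ)) ^ e) * h2
  · rw [saddleTerm, if_neg hk, numOneSided_eq_zero (by omega)]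
    simp

lemma rpow_one_third_pow_three {x : ℝ} (hx : 0 ≤ x) : (x ^ ((1 : ℝ) / 3)) ^ 3 = x := by
  rw [← Real.rpow_natCast, ← Real.rpow_mul hx]
  norm_num

lemma rpow_two_thirds_pow_three {x : ℝ} (hx : 0 ≤ x) : (x ^ ((2 : ℝ) / 3)) ^ 3 = x ^ 2 := by
  rw [← Real.rpow_natCast, ← Real.rpow_mul hx, ← Real.rpow_natCast x 2]
  norm_num

/-- The value 3cL/2 of the exponent at the saddle point, verified by comparing cubes. -/
lemma constA_mul_eq {μ N : ℝ} (hc : 0 < μ + Real.log 2) (hN : 0 ≤ N) :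
    constA μ * N ^ ((1 : ℝ) / 3) = 3 * (μ + Real.log 2) *
      (2 * Real.pi ^ 2 * N / (μ + Real.log 2)) ^ ((1 : ℝ) / 3) / 2 := by
  have hπ := Real.pi_pos
  rw [constA]
  set c := μ + Real.log 2
  rw [← pow_left_inj₀ (by positivity) (by positivity) three_ne_zero, div_pow, mul_pow, mul_pow,
    mul_pow, rpow_two_thirds_pow_three (by positivity), rpow_one_third_pow_three hN,
    rpow_one_third_pow_three (by positivity)]
  field_simp

/-- Converts the Gaussian width: 2πL/(3c) = (π/B) N^{1/3}. -/
lemma constB_mul_eq {μ N : ℝ} (hc : 0 < μ + Real.log 2) (hN : 0 ≤ N) :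
    2 * constB μ * (2 * Real.pi ^ 2 * N / (μ + Real.log 2)) ^ ((1 : ℝ) / 3) =
      3 * (μ + Real.log 2) * N ^ ((1 : ℝ) / 3) := by
  have hπ := Real.pi_pos
  rw [constB]
  set c := μ + Real.log 2
  rw [← pow_left_inj₀ (by positivity) (by positivity) three_ne_zero, mul_pow, mul_pow, mul_pow,
    mul_pow, rpow_two_thirds_pow_three (by positivity), rpow_one_third_pow_three hN,
    rpow_one_third_pow_three (by positivity), mul_pow]
  field_simp
  ring

lemma constB_pos {μ : ℝ} (hc : 0 < μ + Real.log 2) : 0 < constB μ := by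
  have hπ := Real.pi_pos
  rw [constB]
  positivity

/-- The leading term in terms of the saddle point. -/
lemma leading_term_eq {μ : ℝ} (hc : 0 < μ + Real.log 2) {N : ℕ} (hN : 1 ≤ N) {L : ℝ}
    (hL : L = (2 * Real.pi ^ 2 * N / (μ + Real.log 2)) ^ ((1 : ℝ) / 3)) :
    4 * Real.exp μ * Real.sqrt (Real.pi / constB μ) * ((μ + Real.log 2) / 2) *
        Real.exp (-constA μ * (N : ℝ) ^ ((1 : ℝ) / 3)) * (N : ℝ) ^ (-(5 : ℝ) / 6) * (4 : ℝ) ^ N =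
      4 ^ N * Real.exp μ * (Real.exp (3 * (μ + Real.log 2) * L / 2))⁻¹ *
        (L ^ 3 / (4 * Real.pi ^ 2))⁻¹ * (Real.sqrt (Real.pi / constB μ) * (N : ℝ) ^ ((1 : ℝ) / 6)) := by
  have hπ := Real.pi_pos
  have hN0 : (0 : ℝ) < N := by exact_mod_cast hN
  have hA := constA_mul_eq hc hN0.le
  have hL3 : L ^ 3 = 2 * Real.pi ^ 2 * N / (μ + Real.log 2) := by
    rw [hL]; exact rpow_one_third_pow_three (by positivity)
  have hp : (N : ℝ) ^ (-(5 : ℝ) / 6) = (N : ℝ) ^ ((1 : ℝ) / 6) / N := by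
    rw [show -(5 : ℝ) / 6 = 1 / 6 - 1 by norm_num, Real.rpow_sub hN0, Real.rpow_one]
  rw [neg_mul, hA, ← hL, Real.exp_neg, hp, hL3]
  field_simp

lemma sqrt_saddle_eq {μ : ℝ} (hc : 0 < μ + Real.log 2) {N : ℕ} {L : ℝ}
    (hL : L = (2 * Real.pi ^ 2 * N / (μ + Real.log 2)) ^ ((1 : ℝ) / 3)) :
    Real.sqrt (Real.pi * L / (3 * (μ + Real.log 2) / 2)) =
      Real.sqrt (Real.pi / constB μ) * (N : ℝ) ^ ((1 : ℝ) / 6) := by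
  have hN0 : (0 : ℝ) ≤ N := Nat.cast_nonneg N
  have hB := constB_mul_eq hc hN0
  have hB0 := constB_pos hc
  have hπ := Real.pi_pos
  rw [← hL] at hB
  have h6 : (N : ℝ) ^ ((1 : ℝ) / 6) = Real.sqrt ((N : ℝ) ^ ((1 : ℝ) / 3)) := by
    rw [Real.sqrt_eq_rpow, ← Real.rpow_mul hN0]; norm_num
  rw [h6, ← Real.sqrt_mul (by positivity)]
  congr 1
  field_simp
  linarith

theorem mainTheorem5 (μ : ℝ) (hμ : criticalCoupling < μ) (δ : ℝ) (hδ_pos : 0 < δ)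
    (hδ_lt : δ < 1 / 6) :
    ∃ ε : ℕ → ℝ, ε =O[atTop] (fun N : ℕ => (N : ℝ) ^ (-δ)) ∧
      ∀ᶠ N : ℕ in atTop,
        partitionFunction μ N =
          4 * Real.exp μ * Real.sqrt (Real.pi / constB μ) * ((μ + Real.log 2) / 2) *
            Real.exp (-constA μ * (N : ℝ) ^ ((1 : ℝ) / 3)) * (N : ℝ) ^ (-(5 : ℝ) / 6) *
            (4 : ℝ) ^ N * (1 + ε N) := by
  have hc : 0 < μ + Real.log 2 := by rw [criticalCoupling] at hμ; linarith
  have hπ := Real.pi_pos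
  have hB0 := constB_pos hc
  obtain ⟨C, L₀, hC, hL₀, hmain⟩ := exists_saddle_sum_bound hc
  set D : ℕ → ℝ := fun N => 4 * Real.exp μ * Real.sqrt (Real.pi / constB μ) *
    ((μ + Real.log 2) / 2) * Real.exp (-constA μ * (N : ℝ) ^ ((1 : ℝ) / 3)) *
    (N : ℝ) ^ (-(5 : ℝ) / 6) * (4 : ℝ) ^ N with hD
  have hDpos : ∀ N : ℕ, 1 ≤ N → 0 < D N := by
    intro N hN
    have : (0 : ℝ) < N := by exact_mod_cast hN
    have : 0 < Real.sqrt (Real.pi / constB μ) := Real.sqrt_pos.2 (by positivity)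
    simp only [hD]
    positivity
  have hlarge : ∀ᶠ N : ℕ in atTop,
      L₀ ≤ (2 * Real.pi ^ 2 * N / (μ + Real.log 2)) ^ ((1 : ℝ) / 3) := by
    have h1 : Tendsto (fun N : ℕ => 2 * Real.pi ^ 2 / (μ + Real.log 2) * (N : ℝ)) atTop atTop :=
      tendsto_natCast_atTop_atTop.const_mul_atTop (by positivity)
    have h2 := (tendsto_rpow_atTop (show (0 : ℝ) < 1 / 3 by norm_num)).comp h1
    filter_upwards [h2.eventually_ge_atTop L₀] with N hN
    rwa [Function.comp, div_mul_eq_mul_div] at hN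
  refine ⟨fun N => partitionFunction μ N / D N - 1, ?_, ?_⟩
  · refine IsBigO.of_bound (C / Real.sqrt (Real.pi / constB μ)) ?_
    filter_upwards [hlarge, eventually_ge_atTop 1] with N hNL hN
    have hN0 : (0 : ℝ) < N := by exact_mod_cast hN
    set L := (2 * Real.pi ^ 2 * N / (μ + Real.log 2)) ^ ((1 : ℝ) / 3) with hL
    have hL0 : 0 < L := by linarith
    have hL3 : Real.pi ^ 2 * N = (μ + Real.log 2) * L ^ 3 / 2 := by
      rw [hL, rpow_one_third_pow_three (by positivity)]
      field_simp
    have h := hmain L N hNL hL3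
    rw [sqrt_saddle_eq hc hL] at h
    have hs : 0 < Real.sqrt (Real.pi / constB μ) := Real.sqrt_pos.2 (by positivity)
    have hs' : 0 < Real.sqrt (Real.pi / constB μ) * (N : ℝ) ^ ((1 : ℝ) / 6) := by positivity
    have hDN : D N = _ := leading_term_eq hc hN hL
    have hquot : partitionFunction μ N / D N - 1 =
        (L ^ 3 / (4 * Real.pi ^ 2) * (Real.exp (3 * (μ + Real.log 2) * L / 2) *
          ∑' k, saddleTerm (μ + Real.log 2) N k) -
          Real.sqrt (Real.pi / constB μ) * (N : ℝ) ^ ((1 : ℝ) / 6)) /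
          (Real.sqrt (Real.pi / constB μ) * (N : ℝ) ^ ((1 : ℝ) / 6)) := by
      rw [partitionFunction_eq μ hN, hDN]
      field_simp
    rw [hquot, Real.norm_eq_abs, abs_div, abs_of_pos hs', div_le_iff₀ hs']
    refine h.trans ?_
    rw [Real.norm_of_nonneg (by positivity)]
    -- The bound obtained is of order N^{-1/6}; it is weakened to N^{-δ} here.
    have h1 : 1 ≤ (N : ℝ) ^ (-δ) * (N : ℝ) ^ ((1 : ℝ) / 6) := by
      rw [← Real.rpow_add hN0]
      exact Real.one_le_rpow (by exact_mod_cast hN) (by linarith)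
    calc C ≤ C * ((N : ℝ) ^ (-δ) * (N : ℝ) ^ ((1 : ℝ) / 6)) := le_mul_of_one_le_right hC h1
      _ = _ := by field_simp
  · filter_upwards [eventually_ge_atTop 1] with N hN
    have h := (hDpos N hN).ne'
    change partitionFunction μ N = D N * (1 + (partitionFunction μ N / D N - 1))
    field_simp
    ring
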